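/- Let $3\le d\le m$ be integers, $\delta=-1/\log d$, and let $p=(p_0,\dots,p_m)$ be a probability vector with positive entries such that $p_0\le p_m\le p_i$ for $1\le i\le m-1$. Let $\mu$ be the self-similar measure of the maps $x\mapsto (x+i)/d$ with weights $p_i$ ($0\le i\le m$), i.e. the unique compactly supported Borel probability measure on $\mathbb R$ with $\mu(A)=\sum_{i=0}^m p_i\,\mu(dA-i)$ for all Borel $A$. Let $\underline{\dim}\mu(x)$ and $\overline{\dim}\mu(x)$ be the lower and upper limits of $\log\mu(B(x,r))/\log r$ as $r\to0^+$, and write $\dim\mu(x)$ for their common value when they agree. Put $\underline\Delta\mu=\{\underline{\dim}\mu(x):x\in\operatorname{supp}\mu\}$, $\overline\Delta\mu=\{\overline{\dim}\mu(x):x\in\operatorname{supp}\mu\}$ and $\Delta\mu=\{\alpha:\alpha=\dim\mu(x)\text{ for some }x\in\operatorname{supp}\mu\}$. Let $a=1+\lfloor (m-d)/(d-1)\rfloor$, put $p_i=0$ for $i\notin\{0,\dots,m\}$, and for $0\le i\le m$ let $M_i$ be the matrix indexed by $\{-a,\dots,a\}^2$ with entries $M_i(k,l)=p_{-ld+k+i}$.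 For a finite word $\sigma=(\sigma_1,\dots,\sigma_k)$ over $\{0,\dots,m\}$ let $M(\sigma)=M_{\sigma_k}\cdots M_{\sigma_1}$ and $|\sigma|=k$. Let $\rho$ denote the spectral radius, and set $$\tilde\rho(M_0,\dots,M_m)=\limsup_{k\to\infty}\Bigl(\sup\{\rho(A_1\cdots A_k):A_j\in\{M_0,\dots,M_m\}\}\Bigr)^{1/k},$$ $$\underline\rho(M_0,\dots,M_m)=\inf\{\rho(M(\sigma))^{1/|\sigma|}:\ |\sigma|\ge1,\ \sigma_1\notin\{0,m\}\}.$$ Then $\underline\alpha=\delta\log\tilde\rho(M_0,\dots,M_m)$ and $\alpha^*=\delta\log\underline\rho(M_0,\dots,M_m)$ are finite real numbers and, with $\overline\alpha=\delta\log p_0$: 1. $\inf\underline\Delta\mu=\inf\Delta\mu=\underline\alpha$; 2. $\sup\overline\Delta\mu=\sup\Delta\mu=\overline\alpha$, and this common supremum is attained; 3. $\alpha^*$ is the least real number $\beta$ with $\Delta\mu\subset[\underline\alpha,\beta]\cup\{\delta\log p_m\}\cup\{\overline\alpha\}$; 4. if $p_0<p_i$ for all $i=1,\dots,m-1$, then $\alpha^*<\overline\alpha$.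 -/

import Mathlib

open MeasureTheory Filter Topology
open scoped ENNReal

noncomputable section

namespace OverlapMeasure

/-! ### Local dimensions of a measure on the line -/

/-- Lower local dimension: the lower limit of `log μ(B(x,r)) / log r` as `r → 0+`. -/
def lowerLocalDim (μ : Measure ℝ) (x : ℝ) : EReal :=
  liminf (fun r : ℝ => ENNReal.log (μ (Metric.ball x r)) / (Real.log r : EReal)) (𝓝[>] 0)

/-- Upper local dimension: the upper limit of `log μ(B(x,r)) / log r` as `r → 0+`. -/
def upperLocalDim (μ : Measure ℝ) (x : ℝ) : EReal :=
  limsup (fun r : ℝ => ENNReal.log (μ (Metric.ball x r)) / (Real.log r : EReal)) (𝓝[>] 0)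

/-- The set of lower local dimensions at points of the support. -/
def lowerDims (μ : Measure ℝ) : Set EReal :=
  {α | ∃ x ∈ μ.support, lowerLocalDim μ x = α}

/-- The set of upper local dimensions at points of the support. -/
def upperDims (μ : Measure ℝ) : Set EReal :=
  {α | ∃ x ∈ μ.support, upperLocalDim μ x = α}

/-- The set of local dimensions: values `α` such that at some point of the support the local
dimension exists (the upper and lower ones agree) and equals `α`. -/
def localDims (μ : Measure ℝ) : Set EReal :=
  {α | ∃ x ∈ μ.support, lowerLocalDim μ x = α ∧ upperLocalDim μ x = α}

/-! ### The self-similar measure -/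

/-- `μ` is the self-similar measure of the weighted iterated function system
`x ↦ x / d + i / d` with weights `p i`, `0 ≤ i ≤ m`: a compactly supported Borel probability
measure with `μ = ∑ i, p i • (push-forward of μ by the i-th map)`. -/
structure IsSelfSimilar (d : ℕ) {m : ℕ} (p : Fin (m + 1) → ℝ) (μ : Measure ℝ) : Prop where
  isProb : IsProbabilityMeasure μ
  compact_support : IsCompact μ.support
  self_similar : μ = ∑ i : Fin (m + 1),
    ENNReal.ofReal (p i) • μ.map (fun x : ℝ => x / (d : ℝ) + ((i : ℕ) : ℝ) / (d : ℝ))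

/-! ### The transfer matrices -/

/-- The weights extended by zero to all integers. -/
def extWeight {m : ℕ} (p : Fin (m + 1) → ℝ) (n : ℤ) : ℝ :=
  if h : 0 ≤ n ∧ n ≤ (m : ℤ) then p ⟨n.toNat, by omega⟩ else 0

/-- The number `a = 1 + ⌊(m - d) / (d - 1)⌋` (used for `3 ≤ d ≤ m`). -/
def bandwidth (d m : ℕ) : ℕ := 1 + (m - d) / (d - 1)

/-- The index set `{-a, …, a}`. -/
abbrev Idx (d m : ℕ) : Type :=
  ↥(Finset.Icc (-(bandwidth d m : ℤ)) (bandwidth d m : ℤ))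

/-- The transfer matrix `M_i`, with entries `M_i(k,l) = p_{-ld+k+i}`. -/
def transfer (d : ℕ) {m : ℕ} (p : Fin (m + 1) → ℝ) (i : Fin (m + 1)) :
    Matrix (Idx d m) (Idx d m) ℝ :=
  Matrix.of fun k l => extWeight p (-(l : ℤ) * (d : ℤ) + (k : ℤ) + ((i : ℕ) : ℤ))

/-- `M(σ) = M_{σ_k} ⋯ M_{σ_1}` for a word `σ = (σ_1, …, σ_k)`. -/
def wordMatrix (d : ℕ) {m : ℕ} (p : Fin (m + 1) → ℝ) (σ : List (Fin (m + 1))) :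
    Matrix (Idx d m) (Idx d m) ℝ :=
  ((σ.map (transfer d p)).reverse).prod

/-! ### Spectral radii -/

/-- The spectral radius of a real square matrix (the largest modulus of a complex eigenvalue). -/
def rho {n : Type*} [Fintype n] [DecidableEq n] (A : Matrix n n ℝ) : ℝ≥0∞ :=
  spectralRadius ℂ (A.map (fun x : ℝ => (x : ℂ)))

/-- The generalized spectral radius of a family of square matrices:
`limsup_k (sup {ρ(A_1 A_2 ⋯ A_k) : A_i ∈ S})^{1/k}`. -/
def genSpectralRadius {n : Type*} [Fintype n] [DecidableEq n] (S : Set (Matrix n n ℝ)) : ℝ≥0∞ :=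
  limsup (fun k : ℕ =>
    (⨆ L ∈ {L : List (Matrix n n ℝ) | L.length = k ∧ ∀ A ∈ L, A ∈ S}, rho L.prod)
      ^ (1 / (k : ℝ))) atTop

/-- The infimum of `ρ(M(σ))^{1/|σ|}` over the nonempty words `σ` whose first digit is
neither `0` nor `m`. -/
def lowerRho (d : ℕ) {m : ℕ} (p : Fin (m + 1) → ℝ) : ℝ≥0∞ :=
  ⨅ σ ∈ {σ : List (Fin (m + 1)) | ∃ i τ, σ = i :: τ ∧ i ≠ 0 ∧ i ≠ Fin.last m},
    rho (wordMatrix d p σ) ^ (1 / (σ.length : ℝ))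

/-- `δ = -1 / log d`. -/
def delta (d : ℕ) : ℝ := -1 / Real.log d

end OverlapMeasure

end

namespace OverlapMeasure

/-! ### Existence of the self-similar measure -/

/-- Prepending a digit to a digit sequence. -/
def cons {m : ℕ} (i : Fin (m + 1)) (ω : ℕ → Fin (m + 1)) : ℕ → Fin (m + 1)
  | 0 => i
  | n + 1 => ω n

/-- The law of one random digit. -/
noncomputable def digitLaw {m : ℕ} (p : Fin (m + 1) → ℝ) : Measure (Fin (m + 1)) :=
  ∑ i, ENNReal.ofReal (p i) • Measure.dirac i

/-- The sum `∑_n ω_n d^{-(n+1)}`. -/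
noncomputable def proj (d : ℕ) {m : ℕ} (ω : ℕ → Fin (m + 1)) : ℝ := ∑' n, ((ω n : ℕ) : ℝ) / (d : ℝ) ^ (n + 1)

theorem summable_proj {d m : ℕ} (hd : 2 ≤ d) (ω : ℕ → Fin (m + 1)) :
    Summable (fun n => ((ω n : ℕ) : ℝ) / (d : ℝ) ^ (n + 1)) := by
  have hd' : (2 : ℝ) ≤ d := by exact_mod_cast hd
  have h : Summable (fun n : ℕ => ((m : ℝ) / d) * (1 / (d : ℝ)) ^ n) :=
    (summable_geometric_of_lt_one (by positivity)
      (by rw [div_lt_one (by linarith)]; linarith)).mul_left _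
  refine Summable.of_nonneg_of_le (fun n => by positivity) (fun n => ?_) h
  have h1 : ((ω n : ℕ) : ℝ) ≤ m := by exact_mod_cast Nat.lt_succ_iff.mp (ω n).2
  have : ((m : ℝ) / d) * (1 / (d : ℝ)) ^ n = (m : ℝ) / (d : ℝ) ^ (n + 1) := by
    rw [one_div, inv_pow, pow_succ, div_mul_eq_mul_div, div_eq_mul_inv, div_eq_mul_inv, mul_inv]
    ring
  rw [this]
  gcongr

theorem proj_mem {d m : ℕ} (hd : 2 ≤ d) (ω : ℕ → Fin (m + 1)) :
    proj d ω ∈ Set.Icc (0 : ℝ) (∑' n : ℕ, (m : ℝ) / (d : ℝ) ^ (n + 1)) := by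
  refine ⟨tsum_nonneg fun n => by positivity, ?_⟩
  have h := summable_proj (m := m) hd (fun _ => Fin.last m)
  simp only [Fin.val_last] at h
  refine Summable.tsum_le_tsum (fun n => ?_) (summable_proj hd ω) h
  have h1 : ((ω n : ℕ) : ℝ) ≤ m := by exact_mod_cast Nat.lt_succ_iff.mp (ω n).2
  gcongr

theorem proj_cons {d m : ℕ} (hd : 2 ≤ d) (i : Fin (m + 1)) (ω : ℕ → Fin (m + 1)) :
    proj d (cons i ω) = proj d ω / (d : ℝ) + ((i : ℕ) : ℝ) / (d : ℝ) := by
  unfold proj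
  rw [(summable_proj hd (cons i ω)).tsum_eq_zero_add, ← tsum_div_const, add_comm]
  simp only [cons, pow_succ, pow_zero, one_mul, div_div]

theorem measurable_cons {m : ℕ} (i : Fin (m + 1)) : Measurable (cons i) := by
  refine measurable_pi_lambda _ fun n => ?_
  cases n with
  | zero => exact measurable_const
  | succ n => exact measurable_pi_apply n

theorem measurable_proj (d : ℕ) {m : ℕ} : Measurable (proj d (m := m)) := by
  unfold proj
  refine Measurable.tsum fun n => ?_
  exact (measurable_of_countable (fun k : Fin (m + 1) => ((k : ℕ) : ℝ) / (d : ℝ) ^ (n + 1))).comp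
    (measurable_pi_apply n)

theorem isProb_digitLaw {m : ℕ} (p : Fin (m + 1) → ℝ) (hp : ∀ i, 0 ≤ p i) (hs : ∑ i, p i = 1) :
    IsProbabilityMeasure (digitLaw p) := by
  constructor
  simp [digitLaw, ← ENNReal.ofReal_sum_of_nonneg (fun i _ => hp i), hs]

theorem infinitePi_eq {m : ℕ} (p : Fin (m + 1) → ℝ) [IsProbabilityMeasure (digitLaw p)] :
    Measure.infinitePi (fun _ : ℕ => digitLaw p) =
      ∑ i, ENNReal.ofReal (p i) • (Measure.infinitePi (fun _ : ℕ => digitLaw p)).map (cons i) := by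
  classical
  symm
  refine Measure.eq_infinitePi _ fun s t ht => ?_
  obtain ⟨N, hN⟩ : ∃ N, s ⊆ Finset.range (N + 1) := by
    obtain ⟨N, hN⟩ := s.exists_nat_subset_range
    exact ⟨N, hN.trans (Finset.range_mono (Nat.le_succ N))⟩
  set t' : ℕ → Set (Fin (m + 1)) := fun n => if n ∈ s then t n else Set.univ with ht'
  have h1 : Set.pi (s : Set ℕ) t = Set.pi (Finset.range (N + 1) : Set ℕ) t' := by
    ext ω
    simp only [Set.mem_pi, Finset.mem_coe, ht']
    constructor
    · intro h n _
      split_ifs with hn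
      · exact h n hn
      · trivial
    · intro h n hn
      have := h n (hN hn)
      rwa [if_pos hn] at this
  have h2 : ∏ n ∈ s, digitLaw p (t n) = ∏ n ∈ Finset.range (N + 1), digitLaw p (t' n) := by
    rw [← Finset.prod_subset hN]
    · exact Finset.prod_congr rfl fun n hn => by simp [ht', hn]
    · intro n _ hn
      simp [ht', hn]
  have h3 : ∀ i, (cons i) ⁻¹' (Set.pi (Finset.range (N + 1) : Set ℕ) t') =
      if i ∈ t' 0 then Set.pi (Finset.range N : Set ℕ) (fun n => t' (n + 1)) else ∅ := by
    intro i
    ext ω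
    have : ω ∈ (cons i) ⁻¹' (Set.pi (Finset.range (N + 1) : Set ℕ) t') ↔
        i ∈ t' 0 ∧ ∀ n < N, ω n ∈ t' (n + 1) := by
      simp only [Set.mem_preimage, Set.mem_pi, Finset.mem_coe, Finset.mem_range]
      constructor
      · intro h
        exact ⟨h 0 (by omega), fun n hn => h (n + 1) (by omega)⟩
      · rintro ⟨h0, h⟩ n hn
        cases n with
        | zero => exact h0
        | succ n => exact h n (by omega)
    rw [this]
    split_ifs with h0 <;> simp [h0]
  have hm : ∀ A : Set (Fin (m + 1)), MeasurableSet A := fun A => A.toFinite.measurableSet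
  rw [h2, h1, Finset.prod_range_succ']
  simp only [Measure.coe_finsetSum, Measure.coe_smul, Finset.sum_apply, Pi.smul_apply,
    smul_eq_mul]
  have h4 : ∀ i, ENNReal.ofReal (p i) *
      ((Measure.infinitePi (fun _ : ℕ => digitLaw p)).map (cons i))
        (Set.pi (Finset.range (N + 1) : Set ℕ) t') =
      (∏ n ∈ Finset.range N, digitLaw p (t' (n + 1))) *
        (ENNReal.ofReal (p i) * (Measure.dirac i) (t' 0)) := by
    intro i
    rw [Measure.map_apply (measurable_cons i)
      (MeasurableSet.pi (Finset.countable_toSet _) fun _ _ => hm _), h3]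
    rw [Measure.dirac_apply' _ (hm _)]
    split_ifs with h0
    · rw [Measure.infinitePi_pi _ (fun _ _ => hm _)]
      simp [h0, mul_comm]
    · simp [h0]
  rw [Finset.sum_congr rfl fun i _ => h4 i, ← Finset.mul_sum]
  congr 1
  simp [digitLaw]

/-- The self-similar measure exists: it is the law of `∑_n X_n d^{-(n+1)}` with independent
digits `X_n` of law `p`. -/
theorem exists_isSelfSimilar {d m : ℕ} (hd : 2 ≤ d) (p : Fin (m + 1) → ℝ) (hp : ∀ i, 0 ≤ p i)
    (hs : ∑ i, p i = 1) : ∃ μ : Measure ℝ, IsSelfSimilar d p μ := by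
  have := isProb_digitLaw p hp hs
  set ν := Measure.infinitePi (fun _ : ℕ => digitLaw p) with hν
  have hprob : IsProbabilityMeasure (ν.map (proj d)) :=
    Measure.isProbabilityMeasure_map (measurable_proj d).aemeasurable
  refine ⟨ν.map (proj d), hprob, ?_, ?_⟩
  · refine (isCompact_Icc (a := (0 : ℝ)) (b := ∑' n : ℕ, (m : ℝ) / (d : ℝ) ^ (n + 1))).of_isClosed_subset
      Measure.isClosed_support (Measure.support_subset_of_isClosed isClosed_Icc ?_)
    rw [mem_ae_map_iff (measurable_proj d).aemeasurable measurableSet_Icc]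
    exact Filter.univ_mem' fun ω => proj_mem hd ω
  · have hf : ∀ i : Fin (m + 1),
        Measurable (fun x : ℝ => x / (d : ℝ) + ((i : ℕ) : ℝ) / (d : ℝ)) := fun i => by fun_prop
    have h : ν.map (proj d) =
        (∑ i, ENNReal.ofReal (p i) • ν.map (cons i)).map (proj d) := by
      rw [← infinitePi_eq p]
    refine h.trans ?_
    rw [← Measure.mapₗ_apply_of_measurable (measurable_proj d), map_sum]
    refine Finset.sum_congr rfl fun i _ => ?_
    rw [map_smul, Measure.mapₗ_apply_of_measurable (measurable_proj d),
      Measure.map_map (measurable_proj d) (measurable_cons i),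
      Measure.map_map (hf i) (measurable_proj d)]
    congr 2
    funext ω
    exact proj_cons hd i ω

end OverlapMeasure

/-! Write R = m/(d-1) for the right end of the support and call a digit other than 0 and m a middle
digit. The contractions overlap, so a cylinder of a word σ also receives mass from other words. What
matters about such a word is the integer offset between its position and that of σ, rescaled by
d^|σ|. Only offsets in {-a,…,a} can keep the translated cylinder on the support, and M_i(k,l) is the
weight of passing from offset l to offset k while σ reads i. Hence M(σ) expresses the masses of
translated cylinders through masses at unit scale (`IsSelfSimilar.real_cylinder`), and a ball of
radius comparable to d^{-|σ|} has mass comparable to the sum of column 0 of M(σ), the upper bound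
needing distance from the end points (`IsSelfSimilar.real_ball_le`,
`IsSelfSimilar.exists_le_real_ball`). Local dimensions become growth rates of matrix products.

Two positivity facts drive the rest. From every offset some word leads back to 0
(`exists_wordMatrix_zero_pos`), and a middle digit followed by a letters reaches every offset from 0
(`column_pos`). So each word can be completed by boundedly many letters to one that begins with a
middle digit and whose (0,0) entry is comparable to the full entry sum (`exists_completion`). A
diagonal entry is at most the spectral radius, so ball masses are O(ρ̃^n) at interior points. The
end points have rates p_0 and p_m, which are at most ρ̃. This bounds all lower dimensions from
below.

The infimum is approached at fixed points of words beginning with a middle digit: such a point is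
interior and has dimension δ log ρ(M(w))/|w| (`IsSelfSimilar.rate_mem_localDims`). Every interior
point has an expansion with a prefix reaching all offsets, followed by a middle digit. After the
prefix, column 0 dominates the entry sum of the remaining product, hence its spectral radius. This
yields the upper bound α* at interior points. The bound p_0^n for ball masses holds everywhere and
is sharp at 0.

For the minimality of α*, an admissible β bounds the dimensions of all such periodic points except
possibly those equal to one of the two isolated values. These are handled by perturbation: many
copies of the word, a completion, and copies of a short word of rate above p_m give rates slightly
above the given one and off the exceptional values (`exists_word_rate_between`). For the gap, of two
consecutive digits at least one can be rewritten as a middle digit, so rates are at least the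
geometric mean of p_0 and the least middle weight (`row_sum_ge`). -/

namespace OverlapMeasure

/-! ### Nonnegative matrices: entry sums and Gelfand's formula -/

section Spectral

variable {n : Type*} [Fintype n] [DecidableEq n]

/-- The sum of all entries of a real matrix. -/
def entrySum (A : Matrix n n ℝ) : ℝ := ∑ k, ∑ l, A k l

/-- The spectral radius as a real number. -/
noncomputable def realRho (A : Matrix n n ℝ) : ℝ := (rho A).toReal

section

attribute [local instance] Matrix.linftyOpNormedRing Matrix.linftyOpNormedAlgebra

theorem nnnorm_map_le_entrySum {A : Matrix n n ℝ} (hA : ∀ k l, 0 ≤ A k l) :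
    (‖A.map (fun x : ℝ => (x : ℂ))‖₊ : ℝ) ≤ entrySum A := by
  rw [coe_nnnorm]
  have h0 : 0 ≤ entrySum A := Finset.sum_nonneg fun k _ => Finset.sum_nonneg fun l _ => hA k l
  rw [Matrix.linfty_opNorm_def]
  rw [← Real.coe_toNNReal _ h0, NNReal.coe_le_coe]
  refine Finset.sup_le fun k _ => ?_
  rw [← NNReal.coe_le_coe, Real.coe_toNNReal _ h0]
  push_cast
  have : ∀ l, ‖A.map (fun x : ℝ => (x : ℂ)) k l‖ = A k l := fun l => by
    simp [abs_of_nonneg (hA k l)]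
  simp only [this]
  exact Finset.single_le_sum (f := fun k => ∑ l, A k l)
    (fun k _ => Finset.sum_nonneg fun l _ => hA k l) (Finset.mem_univ k)

theorem entrySum_le_card_mul_nnnorm {A : Matrix n n ℝ} (hA : ∀ k l, 0 ≤ A k l) :
    entrySum A ≤ Fintype.card n * (‖A.map (fun x : ℝ => (x : ℂ))‖₊ : ℝ) := by
  rw [coe_nnnorm]
  unfold entrySum
  rw [← nsmul_eq_mul]
  refine Finset.sum_le_card_nsmul _ _ _ fun k _ => ?_
  rw [Matrix.linfty_opNorm_def]
  have h := Finset.le_sup (f := fun i => ∑ j, ‖A.map (fun x : ℝ => (x : ℂ)) i j‖₊)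
    (Finset.mem_univ k)
  refine le_trans (le_of_eq ?_) (NNReal.coe_le_coe.mpr h)
  push_cast
  exact Finset.sum_congr rfl fun l _ => by simp [abs_of_nonneg (hA k l)]

theorem rho_le_nnnorm [Nonempty n] (A : Matrix n n ℝ) :
    rho A ≤ ‖A.map (fun x : ℝ => (x : ℂ))‖₊ :=
  spectrum.spectralRadius_le_nnnorm (𝕜 := ℂ) (A.map (fun x : ℝ => (x : ℂ)))

theorem rho_ne_top [Nonempty n] (A : Matrix n n ℝ) : rho A ≠ ⊤ :=
  ne_top_of_le_ne_top ENNReal.coe_ne_top (rho_le_nnnorm A)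

theorem map_ofReal_pow (A : Matrix n n ℝ) (j : ℕ) :
    (A ^ j).map (fun x : ℝ => (x : ℂ)) = (A.map (fun x : ℝ => (x : ℂ))) ^ j :=
  map_pow (Complex.ofRealHom.mapMatrix) A j

theorem tendsto_nnnorm_pow (A : Matrix n n ℝ) :
    Tendsto (fun j : ℕ => (‖(A ^ j).map (fun x : ℝ => (x : ℂ))‖₊ : ℝ≥0∞) ^ (1 / j : ℝ)) atTop
      (𝓝 (rho A)) := by
  have : CompleteSpace (Matrix n n ℂ) := FiniteDimensional.complete ℂ _
  have h := spectrum.pow_nnnorm_pow_one_div_tendsto_nhds_spectralRadius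
    (A.map (fun x : ℝ => (x : ℂ)))
  simp only [map_ofReal_pow]
  exact h

theorem realRho_le_entrySum [Nonempty n] {A : Matrix n n ℝ} (hA : ∀ k l, 0 ≤ A k l) :
    realRho A ≤ entrySum A :=
  le_trans (ENNReal.toReal_mono ENNReal.coe_ne_top (rho_le_nnnorm A))
    (nnnorm_map_le_entrySum hA)

end

theorem pow_nonneg_entries {A : Matrix n n ℝ} (hA : ∀ k l, 0 ≤ A k l) (j : ℕ) :
    ∀ k l, 0 ≤ (A ^ j) k l := by
  induction j with
  | zero => intro k l; rw [pow_zero, Matrix.one_apply]; split_ifs <;> norm_num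
  | succ j ih =>
    intro k l
    rw [pow_succ, Matrix.mul_apply]
    exact Finset.sum_nonneg fun i _ => mul_nonneg (ih k i) (hA i l)

theorem ofReal_realRho [Nonempty n] (A : Matrix n n ℝ) : ENNReal.ofReal (realRho A) = rho A :=
  ENNReal.ofReal_toReal (rho_ne_top A)

theorem realRho_nonneg (A : Matrix n n ℝ) : 0 ≤ realRho A := ENNReal.toReal_nonneg

theorem rho_pow_le (A : Matrix n n ℝ) {j : ℕ} (hj : j ≠ 0) : rho A ^ j ≤ rho (A ^ j) := by
  unfold rho
  rw [map_ofReal_pow]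
  exact spectrum.spectralRadius_pow_le _ j hj

theorem realRho_pow_le [Nonempty n] (A : Matrix n n ℝ) {j : ℕ} (hj : j ≠ 0) :
    realRho A ^ j ≤ realRho (A ^ j) := by
  unfold realRho
  rw [← ENNReal.toReal_pow]
  exact ENNReal.toReal_mono (rho_ne_top _) (rho_pow_le A hj)

omit [DecidableEq n] in
theorem entrySum_nonneg {A : Matrix n n ℝ} (hA : ∀ k l, 0 ≤ A k l) : 0 ≤ entrySum A :=
  Finset.sum_nonneg fun k _ => Finset.sum_nonneg fun l _ => hA k l

omit [DecidableEq n] in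
theorem entry_le_entrySum {A : Matrix n n ℝ} (hA : ∀ k l, 0 ≤ A k l) (k l : n) :
    A k l ≤ entrySum A :=
  (Finset.single_le_sum (f := fun l => A k l) (fun l _ => hA k l) (Finset.mem_univ l)).trans
    (Finset.single_le_sum (f := fun k => ∑ l, A k l)
      (fun k _ => Finset.sum_nonneg fun l _ => hA k l) (Finset.mem_univ k))

omit [DecidableEq n] in
theorem entrySum_mul_le {A B : Matrix n n ℝ} (hA : ∀ k l, 0 ≤ A k l) (hB : ∀ k l, 0 ≤ B k l) :
    entrySum (A * B) ≤ entrySum A * entrySum B := by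
  have h : ∀ k l, (A * B) k l ≤ ∑ i, A k i * ∑ j, B j l := fun k l => by
    rw [Matrix.mul_apply]
    exact Finset.sum_le_sum fun i _ => mul_le_mul_of_nonneg_left
      (Finset.single_le_sum (f := fun j => B j l) (fun j _ => hB j l) (Finset.mem_univ i)) (hA k i)
  calc entrySum (A * B) ≤ ∑ k, ∑ l, ∑ i, A k i * ∑ j, B j l :=
        Finset.sum_le_sum fun k _ => Finset.sum_le_sum fun l _ => h k l
    _ = entrySum A * entrySum B := by
        unfold entrySum
        rw [Finset.sum_mul]
        refine Finset.sum_congr rfl fun k _ => ?_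
        rw [Finset.sum_comm (f := fun j l => B j l), Finset.mul_sum]
        refine Finset.sum_congr rfl fun l _ => ?_
        rw [Finset.sum_mul]

/-- The powers of a nonnegative matrix grow at most like those of any number above its spectral
radius. -/
theorem exists_entrySum_pow_le [Nonempty n] {A : Matrix n n ℝ} (hA : ∀ k l, 0 ≤ A k l) {s : ℝ}
    (hs : realRho A < s) : ∃ C : ℝ, 0 < C ∧ ∀ j : ℕ, entrySum (A ^ j) ≤ C * s ^ j := by
  have hs0 : 0 < s := (realRho_nonneg A).trans_lt hs
  have hlt : rho A < ENNReal.ofReal s := by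
    rw [← ofReal_realRho A]
    exact (ENNReal.ofReal_lt_ofReal_iff hs0).mpr hs
  have h1 := (tendsto_nnnorm_pow A).eventually (gt_mem_nhds hlt)
  obtain ⟨J, hJ⟩ := eventually_atTop.mp h1
  -- The finite sum pays for the exponents j ≤ J, where Gelfand's limit has not yet taken effect;
  -- `Fintype.card n` is the price of passing from the operator norm to the entry sum for larger j.
  refine ⟨Fintype.card n + ∑ j ∈ Finset.range (J + 1), entrySum (A ^ j) / s ^ j, ?_, fun j => ?_⟩
  · have : 0 < Fintype.card n := Fintype.card_pos
    have h2 : 0 ≤ ∑ j ∈ Finset.range (J + 1), entrySum (A ^ j) / s ^ j :=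
      Finset.sum_nonneg fun j _ => div_nonneg (entrySum_nonneg (pow_nonneg_entries hA j))
        (by positivity)
    positivity
  · have hnn : ∀ j, 0 ≤ entrySum (A ^ j) / s ^ j := fun j =>
      div_nonneg (entrySum_nonneg (pow_nonneg_entries hA j)) (by positivity)
    rw [add_mul]
    by_cases hj : j ≤ J
    · have h2 : entrySum (A ^ j) / s ^ j ≤
          ∑ j ∈ Finset.range (J + 1), entrySum (A ^ j) / s ^ j :=
        Finset.single_le_sum (f := fun j => entrySum (A ^ j) / s ^ j) (fun j _ => hnn j)
          (Finset.mem_range.mpr (by omega))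
      rw [div_le_iff₀ (by positivity)] at h2
      have : 0 ≤ (Fintype.card n : ℝ) * s ^ j := by positivity
      linarith
    · have hj' : (0 : ℝ) < j := by exact_mod_cast (by omega : 0 < j)
      have h3 := hJ j (by omega)
      have h4 := ENNReal.rpow_lt_rpow h3 hj'
      rw [← ENNReal.rpow_mul, one_div, inv_mul_cancel₀ hj'.ne', ENNReal.rpow_one,
        ENNReal.rpow_natCast, ← ENNReal.ofReal_pow hs0.le] at h4
      have h5 := (ENNReal.toReal_mono ENNReal.ofReal_ne_top h4.le)
      rw [ENNReal.toReal_ofReal (by positivity)] at h5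
      have h6 := entrySum_le_card_mul_nnnorm (pow_nonneg_entries hA j)
      have h7 : 0 ≤ (∑ j ∈ Finset.range (J + 1), entrySum (A ^ j) / s ^ j) * s ^ j :=
        mul_nonneg (Finset.sum_nonneg fun j _ => hnn j) (by positivity)
      have h8 : entrySum (A ^ j) ≤ Fintype.card n * s ^ j :=
        h6.trans (mul_le_mul_of_nonneg_left h5 (by positivity))
      linarith

/-- The converse half of Gelfand's formula: if the spectral radius were below s, the powers would be
bounded at a rate t < s, and c s^j would eventually exceed C t^j. Growth of entry sums thus becomes
a lower bound on a spectral radius. -/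
theorem le_realRho_of_le_entrySum_pow [Nonempty n] {A : Matrix n n ℝ} (hA : ∀ k l, 0 ≤ A k l)
    {c s : ℝ} (hc : 0 < c) (h : ∀ j : ℕ, c * s ^ j ≤ entrySum (A ^ j)) : s ≤ realRho A := by
  by_contra hlt
  push Not at hlt
  obtain ⟨t, ht1, ht2⟩ := exists_between hlt
  have ht0 : 0 < t := (realRho_nonneg A).trans_lt ht1
  obtain ⟨C, hC, hC'⟩ := exists_entrySum_pow_le hA ht1
  have h1 : 1 < s / t := (one_lt_div ht0).mpr ht2
  obtain ⟨j, hj⟩ := pow_unbounded_of_one_lt (C / c) h1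
  rw [div_pow, div_lt_div_iff₀ hc (by positivity)] at hj
  have := (h j).trans (hC' j)
  linarith

theorem diag_pow_le {A : Matrix n n ℝ} (hA : ∀ k l, 0 ≤ A k l) (k : n) (j : ℕ) :
    A k k ^ j ≤ (A ^ j) k k := by
  induction j with
  | zero => simp
  | succ j ih =>
    rw [pow_succ, pow_succ, Matrix.mul_apply]
    refine (mul_le_mul_of_nonneg_right ih (hA k k)).trans ?_
    exact Finset.single_le_sum (f := fun i => (A ^ j) k i * A i k)
      (fun i _ => mul_nonneg (pow_nonneg_entries hA j k i) (hA i k)) (Finset.mem_univ k)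

/-- The walk that stays at k already contributes the j-th power of the diagonal entry to the j-th
power of the matrix. -/
theorem diag_le_realRho {A : Matrix n n ℝ} (hA : ∀ k l, 0 ≤ A k l) (k : n) :
    A k k ≤ realRho A := by
  have : Nonempty n := ⟨k⟩
  refine le_realRho_of_le_entrySum_pow hA one_pos fun j => ?_
  rw [one_mul]
  exact (diag_pow_le hA k j).trans (entry_le_entrySum (pow_nonneg_entries hA j) k k)

end Spectral

/-! ### Transfer matrices: the band of offsets and positivity -/

section Transfer

variable {d m : ℕ} {p : Fin (m + 1) → ℝ}

theorem extWeight_of_mem (p : Fin (m + 1) → ℝ) {n : ℤ} (h : 0 ≤ n ∧ n ≤ m) :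
    extWeight p n = p ⟨n.toNat, by omega⟩ := by
  unfold extWeight
  rw [dif_pos h]

theorem extWeight_eq_zero (p : Fin (m + 1) → ℝ) {n : ℤ} (h : ¬(0 ≤ n ∧ n ≤ m)) :
    extWeight p n = 0 := by
  unfold extWeight
  rw [dif_neg h]

theorem extWeight_val (p : Fin (m + 1) → ℝ) (i : Fin (m + 1)) :
    extWeight p ((i : ℕ) : ℤ) = p i := by
  have := i.2
  rw [extWeight_of_mem p (by omega)]
  congr

theorem extWeight_pos (hp : ∀ i, 0 < p i) {n : ℤ} (h : 0 ≤ n ∧ n ≤ m) : 0 < extWeight p n := by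
  rw [extWeight_of_mem p h]
  exact hp _

theorem extWeight_nonneg (hp : ∀ i, 0 < p i) (n : ℤ) : 0 ≤ extWeight p n := by
  by_cases h : 0 ≤ n ∧ n ≤ m
  · exact (extWeight_pos hp h).le
  · rw [extWeight_eq_zero p h]

theorem transfer_apply (i : Fin (m + 1)) (k l : Idx d m) :
    transfer d p i k l = extWeight p (-(l : ℤ) * (d : ℤ) + (k : ℤ) + ((i : ℕ) : ℤ)) := rfl

theorem bandwidth_pos (d m : ℕ) : 1 ≤ bandwidth d m := Nat.le_add_right _ _

/-- With `le_mul_bandwidth_succ` this says a < m/(d-1) ≤ a+1: the bandwidth is the largest integer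
strictly below the right end of the support. -/
theorem mul_bandwidth_lt (hd : 3 ≤ d) (hm : d ≤ m) :
    ((d : ℤ) - 1) * bandwidth d m + 1 ≤ m := by
  obtain ⟨e, rfl⟩ : ∃ e, d = e + 1 := ⟨d - 1, by omega⟩
  obtain ⟨t, rfl⟩ : ∃ t, m = e + 1 + t := ⟨m - (e + 1), by omega⟩
  have h1 : e * (t / e) ≤ t := Nat.mul_div_le t e
  have h2 : bandwidth (e + 1) (e + 1 + t) = 1 + t / e := by
    unfold bandwidth
    congr 2
    omega
  rw [h2]
  zify at h1
  push_cast at h1 ⊢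
  linarith [mul_add (e : ℤ) 1 ((t : ℤ) / e)]

theorem le_mul_bandwidth_succ (hd : 3 ≤ d) (hm : d ≤ m) :
    (m : ℤ) ≤ ((d : ℤ) - 1) * (bandwidth d m + 1) := by
  obtain ⟨e, rfl⟩ : ∃ e, d = e + 1 := ⟨d - 1, by omega⟩
  obtain ⟨t, rfl⟩ : ∃ t, m = e + 1 + t := ⟨m - (e + 1), by omega⟩
  have h1 : t < e * (t / e) + e := by
    have := Nat.div_add_mod t e
    have := Nat.mod_lt t (by omega : 0 < e)
    omega
  have h2 : bandwidth (e + 1) (e + 1 + t) = 1 + t / e := by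
    unfold bandwidth
    congr 2
    omega
  rw [h2]
  zify at h1
  push_cast at h1 ⊢
  linarith [mul_add (e : ℤ) 1 ((t : ℤ) / e), mul_add (e : ℤ) (1 + (t : ℤ) / e) 1]

/-- The index `0`. -/
def zeroIdx (d m : ℕ) : Idx d m := ⟨0, by simp⟩

instance : Nonempty (Idx d m) := ⟨zeroIdx d m⟩

theorem coe_zeroIdx : ((zeroIdx d m : Idx d m) : ℤ) = 0 := rfl

theorem idx_bounds (k : Idx d m) : -(bandwidth d m : ℤ) ≤ k ∧ (k : ℤ) ≤ bandwidth d m :=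
  Finset.mem_Icc.mp k.2

/-- Offsets outside the band never lead back to it. -/
theorem mem_band_of_digit (hd : 3 ≤ d) (hm : d ≤ m) (i : Fin (m + 1)) (k : Idx d m) {l : ℤ}
    (h : 0 ≤ -l * (d : ℤ) + (k : ℤ) + ((i : ℕ) : ℤ) ∧ -l * (d : ℤ) + (k : ℤ) + ((i : ℕ) : ℤ) ≤ m) :
    l ∈ Finset.Icc (-(bandwidth d m : ℤ)) (bandwidth d m : ℤ) := by
  have hi := i.2
  obtain ⟨h1, h2⟩ := idx_bounds k
  have h3 := le_mul_bandwidth_succ hd hm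
  have hd' : (3 : ℤ) ≤ d := by exact_mod_cast hd
  have hi' : ((i : ℕ) : ℤ) ≤ m := by omega
  rw [Finset.mem_Icc]
  constructor
  · by_contra hl
    have hl' : l ≤ -(bandwidth d m : ℤ) - 1 := by omega
    nlinarith [mul_le_mul_of_nonneg_right hl' (by linarith : (0 : ℤ) ≤ d)]
  · by_contra hl
    have hl' : (bandwidth d m : ℤ) + 1 ≤ l := by omega
    nlinarith [mul_le_mul_of_nonneg_right hl' (by linarith : (0 : ℤ) ≤ d)]

theorem wordMatrix_nil : wordMatrix d p [] = 1 := by simp [wordMatrix]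

theorem wordMatrix_append (σ τ : List (Fin (m + 1))) :
    wordMatrix d p (σ ++ τ) = wordMatrix d p τ * wordMatrix d p σ := by
  simp [wordMatrix]

theorem wordMatrix_singleton (i : Fin (m + 1)) : wordMatrix d p [i] = transfer d p i := by
  simp [wordMatrix]

theorem wordMatrix_cons (i : Fin (m + 1)) (σ : List (Fin (m + 1))) :
    wordMatrix d p (i :: σ) = wordMatrix d p σ * transfer d p i := by
  rw [← List.singleton_append, wordMatrix_append, wordMatrix_singleton]

theorem transfer_nonneg (hp : ∀ i, 0 < p i) (i : Fin (m + 1)) (k l : Idx d m) :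
    0 ≤ transfer d p i k l := extWeight_nonneg hp _

theorem wordMatrix_nonneg (hp : ∀ i, 0 < p i) (σ : List (Fin (m + 1))) :
    ∀ k l, 0 ≤ wordMatrix d p σ k l := by
  induction σ with
  | nil =>
    intro k l
    rw [wordMatrix_nil, Matrix.one_apply]
    split_ifs <;> norm_num
  | cons i σ ih =>
    intro k l
    rw [wordMatrix_cons, Matrix.mul_apply]
    exact Finset.sum_nonneg fun j _ => mul_nonneg (ih k j) (transfer_nonneg hp i j l)

theorem mul_le_wordMatrix_append (hp : ∀ i, 0 < p i) (σ τ : List (Fin (m + 1)))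
    (k j l : Idx d m) :
    wordMatrix d p τ k j * wordMatrix d p σ j l ≤ wordMatrix d p (σ ++ τ) k l := by
  rw [wordMatrix_append, Matrix.mul_apply]
  exact Finset.single_le_sum (f := fun j => wordMatrix d p τ k j * wordMatrix d p σ j l)
    (fun j _ => mul_nonneg (wordMatrix_nonneg hp τ k j) (wordMatrix_nonneg hp σ j l))
    (Finset.mem_univ j)

theorem transfer_zero_zero (i : Fin (m + 1)) :
    transfer d p i (zeroIdx d m) (zeroIdx d m) = p i := by
  rw [transfer_apply, coe_zeroIdx, ← extWeight_val p i]
  simp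

theorem pow_le_wordMatrix_zero_zero (hp : ∀ i, 0 < p i) (hmin : ∀ i, p 0 ≤ p i)
    (σ : List (Fin (m + 1))) :
    p 0 ^ σ.length ≤ wordMatrix d p σ (zeroIdx d m) (zeroIdx d m) := by
  induction σ with
  | nil => simp [wordMatrix_nil]
  | cons i σ ih =>
    have h := mul_le_wordMatrix_append hp [i] σ (zeroIdx d m) (zeroIdx d m) (zeroIdx d m)
    rw [wordMatrix_singleton, transfer_zero_zero, List.singleton_append] at h
    refine le_trans ?_ h
    rw [List.length_cons, pow_succ]
    exact mul_le_mul ih (hmin i) (hp 0).le (wordMatrix_nonneg hp _ _ _)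

theorem wordMatrix_zero_zero_pos (hp : ∀ i, 0 < p i) (hmin : ∀ i, p 0 ≤ p i)
    (σ : List (Fin (m + 1))) : 0 < wordMatrix d p σ (zeroIdx d m) (zeroIdx d m) :=
  (pow_pos (hp 0) _).trans_le (pow_le_wordMatrix_zero_zero hp hmin σ)

/-- The `j`-fold concatenation of a word with itself. -/
def wordPow (σ : List (Fin (m + 1))) (j : ℕ) : List (Fin (m + 1)) := (List.replicate j σ).flatten

theorem wordPow_succ (σ : List (Fin (m + 1))) (j : ℕ) :
    wordPow σ (j + 1) = σ ++ wordPow σ j := by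
  simp [wordPow, List.replicate_succ]

theorem length_wordPow (σ : List (Fin (m + 1))) (j : ℕ) :
    (wordPow σ j).length = j * σ.length := by
  simp [wordPow]

theorem wordMatrix_wordPow (σ : List (Fin (m + 1))) (j : ℕ) :
    wordMatrix d p (wordPow σ j) = wordMatrix d p σ ^ j := by
  induction j with
  | zero => simp [wordPow, wordMatrix_nil]
  | succ j ih => rw [wordPow_succ, wordMatrix_append, ih, pow_succ]

/-- From every offset some word leads back to offset zero. -/
theorem exists_wordMatrix_zero_pos (hd : 3 ≤ d) (hm : d ≤ m) (hp : ∀ i, 0 < p i)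
    (k : Idx d m) : ∃ θ, 0 < wordMatrix d p θ (zeroIdx d m) k := by
  have hb := mul_bandwidth_lt hd hm
  have hd' : (3 : ℤ) ≤ d := by exact_mod_cast hd
  have key : ∀ N : ℕ, ∀ k : Idx d m, (k : ℤ).natAbs = N →
      ∃ θ, 0 < wordMatrix d p θ (zeroIdx d m) k := by
    intro N
    induction N with
    | zero =>
      intro k hk
      have : k = zeroIdx d m := Subtype.ext (by rw [coe_zeroIdx]; omega)
      exact ⟨[], by rw [this, wordMatrix_nil]; simp⟩
    | succ N ih =>
      intro k hk
      obtain ⟨h1, h2⟩ := idx_bounds k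
      obtain ⟨i, k', hk', hpos⟩ : ∃ (i : Fin (m + 1)) (k' : Idx d m),
          (k' : ℤ).natAbs = N ∧ 0 < transfer d p i k' k := by
        -- One step towards zero: digit (d-1)k+1 takes k > 0 to k-1 with weight index 0, and digit 0
        -- takes k < 0 to k+1 with weight index (d-1)|k|+1. Both indices are at most m because
        -- (d-1)a+1 ≤ m.
        rcases lt_or_ge (0 : ℤ) k with h0 | h0
        · have hle : ((d : ℤ) - 1) * k + 1 ≤ m := by nlinarith
          have hge : 0 ≤ ((d : ℤ) - 1) * k + 1 := by nlinarith
          refine ⟨⟨(((d : ℤ) - 1) * k + 1).toNat, by omega⟩, ⟨k - 1, by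
            rw [Finset.mem_Icc]; omega⟩, by dsimp only; omega, ?_⟩
          rw [transfer_apply]
          refine extWeight_pos hp ?_
          dsimp only
          rw [Int.toNat_of_nonneg hge]
          constructor <;> nlinarith
        · refine ⟨0, ⟨k + 1, by rw [Finset.mem_Icc]; omega⟩, by dsimp only; omega, ?_⟩
          rw [transfer_apply]
          refine extWeight_pos hp ?_
          simp only [Fin.val_zero, Nat.cast_zero]
          have : (k : ℤ) ≤ -1 := by omega
          constructor <;> nlinarith
      obtain ⟨θ, hθ⟩ := ih k' hk'
      refine ⟨i :: θ, ?_⟩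
      have h := mul_le_wordMatrix_append hp [i] θ (zeroIdx d m) k' k
      rw [wordMatrix_singleton] at h
      exact (mul_pos hθ hpos).trans_le h
  exact key _ k rfl

/-- Offset k is entered from l exactly when k+i-ld lies in {0,…,m}. Since m ≥ d, the quotient l =
⌊(k+i)/d⌋ always qualifies, and when it exceeds j the offset j itself does. Division by d contracts,
so the reachable window widens by at least one at each letter. -/
theorem column_pos_step (hd : 3 ≤ d) (hm : d ≤ m) (hp : ∀ i, 0 < p i)
    {σ : List (Fin (m + 1))} {j : ℤ} (hj : 1 ≤ j)
    (h : ∀ l : Idx d m, |(l : ℤ)| ≤ j → 0 < wordMatrix d p σ l (zeroIdx d m)) (i : Fin (m + 1)) :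
    ∀ l : Idx d m, |(l : ℤ)| ≤ j + 1 → 0 < wordMatrix d p (σ ++ [i]) l (zeroIdx d m) := by
  intro k hk
  have hd' : (3 : ℤ) ≤ d := by exact_mod_cast hd
  have hm' : (d : ℤ) ≤ m := by exact_mod_cast hm
  have hi := i.2
  rw [abs_le] at hk
  obtain ⟨l, hl1, hl2, hl3⟩ : ∃ l : ℤ, |l| ≤ j ∧ 0 ≤ -l * (d : ℤ) + (k : ℤ) + ((i : ℕ) : ℤ) ∧
      -l * (d : ℤ) + (k : ℤ) + ((i : ℕ) : ℤ) ≤ m := by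
    have e1 := Int.mul_ediv_add_emod ((k : ℤ) + ((i : ℕ) : ℤ)) d
    have e2 := Int.emod_nonneg ((k : ℤ) + ((i : ℕ) : ℤ)) (by omega : (d : ℤ) ≠ 0)
    have e3 := Int.emod_lt_of_pos ((k : ℤ) + ((i : ℕ) : ℤ)) (by omega : 0 < (d : ℤ))
    set q := ((k : ℤ) + ((i : ℕ) : ℤ)) / d
    by_cases hq : q ≤ j
    · refine ⟨q, abs_le.mpr ⟨?_, hq⟩, by nlinarith, by nlinarith⟩
      by_contra hlt
      have : q ≤ -j - 1 := by omega
      nlinarith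
    · refine ⟨j, by rw [abs_of_nonneg (by omega)], ?_, ?_⟩
      · have : j + 1 ≤ q := by omega
        nlinarith
      · have : (k : ℤ) ≤ j + 1 := hk.2
        have : ((i : ℕ) : ℤ) ≤ m := by omega
        nlinarith
  have hmem := mem_band_of_digit hd hm i k ⟨hl2, hl3⟩
  have h1 := mul_le_wordMatrix_append hp σ [i] k ⟨l, hmem⟩ (zeroIdx d m)
  rw [wordMatrix_singleton] at h1
  refine lt_of_lt_of_le (mul_pos ?_ (h ⟨l, hmem⟩ hl1)) h1
  rw [transfer_apply]
  exact extWeight_pos hp ⟨hl2, hl3⟩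

/-- After a middle digit, the offsets reached from zero fill the band. -/
theorem column_pos (hd : 3 ≤ d) (hm : d ≤ m) (hp : ∀ i, 0 < p i) {i : Fin (m + 1)}
    (hi0 : i ≠ 0) (him : i ≠ Fin.last m) {θ : List (Fin (m + 1))}
    (hθ : bandwidth d m ≤ θ.length) (l : Idx d m) :
    0 < wordMatrix d p (i :: θ) l (zeroIdx d m) := by
  have h0 : (i : ℕ) ≠ 0 := fun h => hi0 (Fin.ext h)
  have h1 : (i : ℕ) ≠ m := fun h => him (Fin.ext h)
  have h2 := i.2
  have key : ∀ θ : List (Fin (m + 1)), ∀ l : Idx d m, |(l : ℤ)| ≤ θ.length + 1 →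
      0 < wordMatrix d p (i :: θ) l (zeroIdx d m) := by
    intro θ
    induction θ using List.reverseRecOn with
    | nil =>
      intro l hl
      rw [wordMatrix_singleton, transfer_apply, coe_zeroIdx]
      simp only [List.length_nil, Nat.cast_zero, zero_add, abs_le] at hl
      -- For a middle digit all three of i-1, i, i+1 are digits, so the offsets -1, 0, 1 are reached
      -- at once; this window of radius 1 is what `column_pos_step` needs to start.
      exact extWeight_pos hp (by omega)
    | append_singleton θ j ih =>
      rw [← List.cons_append]
      have := column_pos_step hd hm hp (by omega) ih j
      simpa using this
  refine key θ l ?_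
  obtain ⟨h3, h4⟩ := idx_bounds l
  rw [abs_le]
  constructor <;> omega

theorem exists_digit_entry (hd : 3 ≤ d) (hm : d ≤ m) (hmin : ∀ i, p 0 ≤ p i)
    (i : Fin (m + 1)) (k : Idx d m) : ∃ j : Idx d m, p 0 ≤ transfer d p i k j := by
  have e1 := Int.mul_ediv_add_emod ((k : ℤ) + ((i : ℕ) : ℤ)) d
  have e2 := Int.emod_nonneg ((k : ℤ) + ((i : ℕ) : ℤ)) (by omega : (d : ℤ) ≠ 0)
  have e3 := Int.emod_lt_of_pos ((k : ℤ) + ((i : ℕ) : ℤ)) (by omega : 0 < (d : ℤ))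
  have h : 0 ≤ -(((k : ℤ) + ((i : ℕ) : ℤ)) / d) * (d : ℤ) + (k : ℤ) + ((i : ℕ) : ℤ) ∧
      -(((k : ℤ) + ((i : ℕ) : ℤ)) / d) * (d : ℤ) + (k : ℤ) + ((i : ℕ) : ℤ) ≤ m := by
    constructor <;> nlinarith
  refine ⟨⟨_, mem_band_of_digit hd hm i k h⟩, ?_⟩
  rw [transfer_apply, extWeight_of_mem p h]
  exact hmin _

theorem le_extWeight_of_mid {q : ℝ} (hq : ∀ i : Fin (m + 1), i ≠ 0 → i ≠ Fin.last m → q ≤ p i)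
    {n : ℤ} (h : 1 ≤ n ∧ n ≤ (m : ℤ) - 1) : q ≤ extWeight p n := by
  rw [extWeight_of_mem p (by omega)]
  refine hq _ (fun h0 => ?_) (fun h0 => ?_)
  · have := congrArg Fin.val h0
    simp only [Fin.val_zero] at this
    omega
  · have := congrArg Fin.val h0
    simp only [Fin.val_last] at this
    omega

/-- The digits that can replace i when arriving at offset k form a residue class modulo d inside
{0,…,m}. The class contains a middle digit unless it is {0, m}, which forces d = m and residue 0. -/
theorem exists_mid_digit_entry (hd : 3 ≤ d) (hm : d ≤ m) {q : ℝ}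
    (hq : ∀ i : Fin (m + 1), i ≠ 0 → i ≠ Fin.last m → q ≤ p i)
    (i : Fin (m + 1)) (k : Idx d m) (h : d < m ∨ ¬ (d : ℤ) ∣ (k : ℤ) + ((i : ℕ) : ℤ)) :
    ∃ j : Idx d m, q ≤ transfer d p i k j := by
  have e1 := Int.mul_ediv_add_emod ((k : ℤ) + ((i : ℕ) : ℤ)) d
  have e2 := Int.emod_nonneg ((k : ℤ) + ((i : ℕ) : ℤ)) (by omega : (d : ℤ) ≠ 0)
  have e3 := Int.emod_lt_of_pos ((k : ℤ) + ((i : ℕ) : ℤ)) (by omega : 0 < (d : ℤ))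
  obtain ⟨l, hl⟩ : ∃ l : ℤ, 1 ≤ -l * (d : ℤ) + (k : ℤ) + ((i : ℕ) : ℤ) ∧
      -l * (d : ℤ) + (k : ℤ) + ((i : ℕ) : ℤ) ≤ (m : ℤ) - 1 := by
    by_cases hdvd : (d : ℤ) ∣ (k : ℤ) + ((i : ℕ) : ℤ)
    · refine ⟨((k : ℤ) + ((i : ℕ) : ℤ)) / d - 1, ?_⟩
      have hlt : d < m := by tauto
      have := Int.emod_eq_zero_of_dvd hdvd
      constructor <;> nlinarith
    · refine ⟨((k : ℤ) + ((i : ℕ) : ℤ)) / d, ?_⟩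
      have h0 : ((k : ℤ) + ((i : ℕ) : ℤ)) % d ≠ 0 := fun h0 => hdvd (Int.dvd_of_emod_eq_zero h0)
      have : 1 ≤ ((k : ℤ) + ((i : ℕ) : ℤ)) % d := by omega
      constructor <;> nlinarith
  refine ⟨⟨l, mem_band_of_digit hd hm i k (by omega)⟩, ?_⟩
  rw [transfer_apply]
  exact le_extWeight_of_mid hq hl

/-- Of any two consecutive digits, at least one can be rewritten as a middle digit. -/
theorem exists_two_step_entry (hd : 3 ≤ d) (hm : d ≤ m) (hp : ∀ i, 0 < p i)
    (hmin : ∀ i, p 0 ≤ p i) {q : ℝ} (hq0 : 0 < q)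
    (hq : ∀ i : Fin (m + 1), i ≠ 0 → i ≠ Fin.last m → q ≤ p i) (i i' : Fin (m + 1))
    (k : Idx d m) : ∃ j h : Idx d m, p 0 * q ≤ transfer d p i' k j * transfer d p i j h := by
  by_cases hc : d < m ∨ ¬ (d : ℤ) ∣ (k : ℤ) + ((i' : ℕ) : ℤ)
  · obtain ⟨j, hj⟩ := exists_mid_digit_entry hd hm hq i' k hc
    obtain ⟨h, hh⟩ := exists_digit_entry hd hm hmin i j
    refine ⟨j, h, ?_⟩
    rw [mul_comm]
    exact mul_le_mul hj hh (hp 0).le (transfer_nonneg hp _ _ _)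
  · push Not at hc
    obtain ⟨hdm, c, hc⟩ := hc
    have hdm : d = m := le_antisymm hm hdm
    have h0 : 0 ≤ -c * (d : ℤ) + (k : ℤ) + ((i' : ℕ) : ℤ) ∧
      -c * (d : ℤ) + (k : ℤ) + ((i' : ℕ) : ℤ) ≤ m := by constructor <;> nlinarith
    have h1 : 0 ≤ -(c - 1) * (d : ℤ) + (k : ℤ) + ((i' : ℕ) : ℤ) ∧
      -(c - 1) * (d : ℤ) + (k : ℤ) + ((i' : ℕ) : ℤ) ≤ m := by
      have hdm' : (d : ℤ) = m := by exact_mod_cast hdm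
      constructor <;> nlinarith
    have hw : ∀ l (hl : 0 ≤ -l * (d : ℤ) + (k : ℤ) + ((i' : ℕ) : ℤ) ∧
        -l * (d : ℤ) + (k : ℤ) + ((i' : ℕ) : ℤ) ≤ m),
        p 0 ≤ transfer d p i' k ⟨l, mem_band_of_digit hd hm i' k hl⟩ := fun l hl => by
      rw [transfer_apply, extWeight_of_mem p hl]
      exact hmin _
    -- In the exceptional class the digits 0 and d are both available, so there are two adjacent
    -- choices c and c-1 for the previous offset. They cannot both be exceptional for the previous
    -- digit, since d does not divide 1.
    have hsel : ¬ (d : ℤ) ∣ c + ((i : ℕ) : ℤ) ∨ ¬ (d : ℤ) ∣ (c - 1) + ((i : ℕ) : ℤ) := by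
      by_contra hcon
      push Not at hcon
      have := dvd_sub hcon.1 hcon.2
      have h1 : (c + ((i : ℕ) : ℤ)) - (c - 1 + ((i : ℕ) : ℤ)) = 1 := by ring
      rw [h1] at this
      have := Int.le_of_dvd one_pos this
      omega
    rcases hsel with hs | hs
    · obtain ⟨h, hh⟩ := exists_mid_digit_entry hd hm hq i
        ⟨c, mem_band_of_digit hd hm i' k h0⟩ (Or.inr hs)
      exact ⟨_, h, mul_le_mul (hw c h0) hh hq0.le (transfer_nonneg hp _ _ _)⟩
    · obtain ⟨h, hh⟩ := exists_mid_digit_entry hd hm hq i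
        ⟨c - 1, mem_band_of_digit hd hm i' k h1⟩ (Or.inr hs)
      exact ⟨_, h, mul_le_mul (hw (c - 1) h1) hh hq0.le (transfer_nonneg hp _ _ _)⟩

theorem row_sum_append_ge (hp : ∀ i, 0 < p i) (σ τ : List (Fin (m + 1))) (k j : Idx d m) :
    wordMatrix d p τ k j * ∑ l, wordMatrix d p σ j l ≤ ∑ l, wordMatrix d p (σ ++ τ) k l := by
  rw [Finset.mul_sum]
  exact Finset.sum_le_sum fun l _ => mul_le_wordMatrix_append hp σ τ k j l

/-- Rows of M(σ) see the word from its end, so letters are peeled off there in pairs, each pair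
paying p_0 q = s² by `exists_two_step_entry`. The extra factor p_0 covers a single leftover letter.
-/
theorem row_sum_ge (hd : 3 ≤ d) (hm : d ≤ m) (hp : ∀ i, 0 < p i)
    (hmin : ∀ i, p 0 ≤ p i) (hp1 : p 0 ≤ 1) {q : ℝ} (hq0 : 0 < q)
    (hq : ∀ i : Fin (m + 1), i ≠ 0 → i ≠ Fin.last m → q ≤ p i) {s : ℝ} (hs0 : 0 ≤ s)
    (hs1 : s ≤ 1) (hs : s ^ 2 = p 0 * q) (n : ℕ) :
    ∀ σ : List (Fin (m + 1)), σ.length = n → ∀ k : Idx d m,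
      p 0 * s ^ n ≤ ∑ l, wordMatrix d p σ k l := by
  induction n using Nat.twoStepInduction with
  | zero =>
    intro σ hσ k
    rw [List.length_eq_zero_iff] at hσ
    subst hσ
    simpa [wordMatrix_nil, Matrix.one_apply] using hp1
  | one =>
    intro σ hσ k
    obtain ⟨i, rfl⟩ := List.length_eq_one_iff.mp hσ
    obtain ⟨j, hj⟩ := exists_digit_entry hd hm hmin i k
    rw [wordMatrix_singleton, pow_one]
    calc p 0 * s ≤ p 0 := mul_le_of_le_one_right (hp 0).le hs1
      _ ≤ _ := hj
      _ ≤ _ := Finset.single_le_sum (f := fun l => transfer d p i k l)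
        (fun l _ => transfer_nonneg hp i k l) (Finset.mem_univ j)
  | more n ih _ =>
    intro σ hσ k
    obtain ⟨σ', i, i', rfl⟩ : ∃ σ' i i', σ = σ' ++ [i, i'] := by
      rcases List.eq_nil_or_concat σ with rfl | ⟨σ1, i', rfl⟩
      · simp at hσ
      · rcases List.eq_nil_or_concat σ1 with rfl | ⟨σ2, i, rfl⟩
        · simp at hσ
        · exact ⟨σ2, i, i', by simp⟩
    obtain ⟨j, h, hjh⟩ := exists_two_step_entry hd hm hp hmin hq0 hq i i' k
    have h1 := ih σ' (by simpa using hσ) h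
    have h2 := row_sum_append_ge hp σ' [i, i'] k h
    have h3 := mul_le_wordMatrix_append (d := d) hp [i] [i'] k j h
    rw [wordMatrix_singleton, wordMatrix_singleton, List.singleton_append] at h3
    calc p 0 * s ^ (n + 2) = (p 0 * q) * (p 0 * s ^ n) := by rw [← hs]; ring
      _ ≤ wordMatrix d p [i, i'] k h * ∑ l, wordMatrix d p σ' h l :=
        mul_le_mul (hjh.trans h3) h1 (mul_nonneg (hp 0).le (pow_nonneg hs0 _))
          (wordMatrix_nonneg hp _ _ _)
      _ ≤ _ := h2

theorem pow_le_realRho_wordMatrix (hd : 3 ≤ d) (hm : d ≤ m) (hp : ∀ i, 0 < p i)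
    (hmin : ∀ i, p 0 ≤ p i) (hp1 : p 0 ≤ 1) {q : ℝ} (hq0 : 0 < q)
    (hq : ∀ i : Fin (m + 1), i ≠ 0 → i ≠ Fin.last m → q ≤ p i) {s : ℝ} (hs0 : 0 ≤ s)
    (hs1 : s ≤ 1) (hs : s ^ 2 = p 0 * q) (σ : List (Fin (m + 1))) :
    s ^ σ.length ≤ realRho (wordMatrix d p σ) := by
  refine le_realRho_of_le_entrySum_pow (wordMatrix_nonneg hp σ) (hp 0) fun j => ?_
  rw [← wordMatrix_wordPow, ← pow_mul, mul_comm σ.length, ← length_wordPow]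
  exact (row_sum_ge hd hm hp hmin hp1 hq0 hq hs0 hs1 hs _ _ rfl (zeroIdx d m)).trans
    (Finset.single_le_sum (f := fun k => ∑ l, wordMatrix d p (wordPow σ j) k l)
      (fun k _ => Finset.sum_nonneg fun l _ => wordMatrix_nonneg hp _ k l) (Finset.mem_univ _))

/-- The word `1 d` has a diagonal entry above the square of the last weight. -/
theorem exists_word_overlap_gain (hd : 3 ≤ d) (hm : d ≤ m) (hp : ∀ i, 0 < p i)
    (hreg : ∀ i : Fin (m + 1), i ≠ 0 → p (Fin.last m) ≤ p i) :
    ∃ κ : List (Fin (m + 1)), κ.length = 2 ∧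
      p (Fin.last m) ^ 2 < wordMatrix d p κ (zeroIdx d m) (zeroIdx d m) := by
  let i1 : Fin (m + 1) := ⟨1, by omega⟩
  let i2 : Fin (m + 1) := ⟨2, by omega⟩
  let id : Fin (m + 1) := ⟨d, by omega⟩
  have hb := bandwidth_pos d m
  let e : Idx d m := ⟨1, by rw [Finset.mem_Icc]; omega⟩
  refine ⟨[i1, id], rfl, ?_⟩
  have hne : zeroIdx d m ≠ e := fun h => by
    have := congrArg Subtype.val h
    rw [coe_zeroIdx] at this
    exact absurd this (by norm_num [e])
  rw [wordMatrix_cons, wordMatrix_singleton, Matrix.mul_apply]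
  have h1 : ∑ j ∈ {zeroIdx d m, e}, transfer d p id (zeroIdx d m) j *
        transfer d p i1 j (zeroIdx d m) ≤
      ∑ j, transfer d p id (zeroIdx d m) j * transfer d p i1 j (zeroIdx d m) :=
    Finset.sum_le_sum_of_subset_of_nonneg (Finset.subset_univ _)
      fun j _ _ => mul_nonneg (transfer_nonneg hp _ _ _) (transfer_nonneg hp _ _ _)
  rw [Finset.sum_pair hne, transfer_zero_zero, transfer_zero_zero] at h1
  have h2 : transfer d p id (zeroIdx d m) e = p 0 := by
    rw [transfer_apply, ← extWeight_val p 0, coe_zeroIdx]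
    congr 1
    simp [e, id]
  have h3 : transfer d p i1 e (zeroIdx d m) = p i2 := by
    rw [transfer_apply, ← extWeight_val p i2, coe_zeroIdx]
    congr 1
    norm_num [e, i1, i2]
  rw [h2, h3] at h1
  refine lt_of_lt_of_le ?_ h1
  have h4 : p (Fin.last m) ≤ p id := hreg _ (fun h => by
    have := congrArg Fin.val h; simp [id] at this; omega)
  have h5 : p (Fin.last m) ≤ p i1 := hreg _ (fun h => by
    have := congrArg Fin.val h; simp [i1] at this)
  have h6 := mul_pos (hp 0) (hp i2)
  have h7 := mul_le_mul h4 h5 (hp _).le (hp _).le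
  nlinarith

end Transfer

/-! ### Digit expansions of points of the support interval -/

section Words

variable {d m : ℕ}

/-- The right end point `m / (d - 1)` of the support. -/
noncomputable def rightEnd (d m : ℕ) : ℝ := (m : ℝ) / ((d : ℝ) - 1)

/-- The composition of the contractions `y ↦ (y + i) / d` along a word. -/
noncomputable def contract (d : ℕ) {m : ℕ} : List (Fin (m + 1)) → ℝ → ℝ
  | [], y => y
  | i :: σ, y => (contract d σ y + ((i : ℕ) : ℝ)) / d

/-- The inverse of `contract`. -/
noncomputable def expand (d : ℕ) {m : ℕ} : List (Fin (m + 1)) → ℝ → ℝ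
  | [], z => z
  | i :: σ, z => expand d σ (d * z - ((i : ℕ) : ℝ))

theorem contract_append (σ τ : List (Fin (m + 1))) (y : ℝ) :
    contract d (σ ++ τ) y = contract d σ (contract d τ y) := by
  induction σ with
  | nil => rfl
  | cons i σ ih => simp only [List.cons_append, contract, ih]

theorem expand_sub (hd : 3 ≤ d) (σ : List (Fin (m + 1))) (y z : ℝ) :
    expand d σ z - y = (d : ℝ) ^ σ.length * (z - contract d σ y) := by
  have hd0 : (d : ℝ) ≠ 0 := by positivity
  induction σ generalizing z with
  | nil => simp [expand, contract]
  | cons i σ ih =>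
    simp only [expand, contract, ih, List.length_cons, pow_succ]
    field_simp
    ring

theorem contract_sub (hd : 3 ≤ d) (σ : List (Fin (m + 1))) (x y : ℝ) :
    contract d σ x - contract d σ y = (x - y) / (d : ℝ) ^ σ.length := by
  have hd0 : (d : ℝ) ≠ 0 := by positivity
  induction σ with
  | nil => simp [contract]
  | cons i σ ih =>
    simp only [contract, List.length_cons, pow_succ]
    rw [← div_div, ← ih]
    field_simp
    ring

theorem measurable_expand (σ : List (Fin (m + 1))) : Measurable (expand d σ) := by
  induction σ with
  | nil => exact measurable_id
  | cons i σ ih =>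
    have : Measurable (fun z : ℝ => (d : ℝ) * z - ((i : ℕ) : ℝ)) := by fun_prop
    exact ih.comp this

theorem rightEnd_eq (hd : 3 ≤ d) : (d : ℝ) * rightEnd d m = rightEnd d m + m := by
  have : (3 : ℝ) ≤ d := by exact_mod_cast hd
  unfold rightEnd
  have : (d : ℝ) - 1 ≠ 0 := by linarith
  field_simp
  ring

theorem digit_le (i : Fin (m + 1)) : ((i : ℕ) : ℝ) ≤ m := by
  exact_mod_cast Nat.lt_succ_iff.mp i.2

/-- Since m ≥ d, the length R is at least d/(d-1) > 1 + 1/d. A remainder window of length 1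
therefore fits in [0, R] with a margin of 1/(2d) on both sides. -/
theorem one_add_inv_lt_rightEnd (hd : 3 ≤ d) (hm : d ≤ m) : 1 + 1 / (d : ℝ) < rightEnd d m := by
  have h3 : (3 : ℝ) ≤ d := by exact_mod_cast hd
  have h4 : (d : ℝ) ≤ m := by exact_mod_cast hm
  unfold rightEnd
  rw [lt_div_iff₀ (by linarith)]
  have : (1 + 1 / (d : ℝ)) * (d - 1) = d - 1 / d := by field_simp; ring
  rw [this]
  have : 0 < 1 / (d : ℝ) := by positivity
  linarith

theorem one_lt_rightEnd (hd : 3 ≤ d) (hm : d ≤ m) : 1 < rightEnd d m := by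
  have := one_add_inv_lt_rightEnd hd hm
  have : 0 < 1 / (d : ℝ) := by positivity
  linarith

theorem mem_Ioo_of_expand_mem (hd : 3 ≤ d) (σ : List (Fin (m + 1))) {z : ℝ}
    (hz : expand d σ z ∈ Set.Ioo 0 (rightEnd d m)) : z ∈ Set.Ioo 0 (rightEnd d m) := by
  have h3 : (3 : ℝ) ≤ d := by exact_mod_cast hd
  induction σ generalizing z with
  | nil => exact hz
  | cons i σ ih =>
    obtain ⟨h1, h2⟩ := ih hz
    have h4 := digit_le i
    have h5 : (0 : ℝ) ≤ ((i : ℕ) : ℝ) := by positivity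
    have h6 := rightEnd_eq (m := m) hd
    constructor <;> nlinarith

theorem contract_mem_Icc (hd : 3 ≤ d) (σ : List (Fin (m + 1))) {y : ℝ}
    (hy : y ∈ Set.Icc 0 (rightEnd d m)) : contract d σ y ∈ Set.Icc 0 (rightEnd d m) := by
  have h3 : (3 : ℝ) ≤ d := by exact_mod_cast hd
  induction σ with
  | nil => exact hy
  | cons i σ ih =>
    obtain ⟨h1, h2⟩ := ih
    have h4 := digit_le i
    have h6 := rightEnd_eq (m := m) hd
    refine ⟨div_nonneg (add_nonneg h1 (by positivity)) (by positivity), ?_⟩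
    simp only [contract]
    rw [div_le_iff₀ (by positivity)]
    linarith

theorem contract_mem_Ioo (hd : 3 ≤ d) {i : Fin (m + 1)} (hi0 : i ≠ 0) (him : i ≠ Fin.last m)
    (σ : List (Fin (m + 1))) {y : ℝ} (hy : y ∈ Set.Icc 0 (rightEnd d m)) :
    contract d (i :: σ) y ∈ Set.Ioo 0 (rightEnd d m) := by
  have h3 : (3 : ℝ) ≤ d := by exact_mod_cast hd
  obtain ⟨h1, h2⟩ := contract_mem_Icc hd σ hy
  have h6 := rightEnd_eq (m := m) hd
  have h7 : (0 : ℝ) < ((i : ℕ) : ℝ) := by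
    have : (i : ℕ) ≠ 0 := fun h => hi0 (Fin.ext h)
    positivity
  have h8 : ((i : ℕ) : ℝ) < m := by
    have h1 : (i : ℕ) ≠ m := fun h => him (Fin.ext h)
    have h2 := i.2
    exact_mod_cast (by omega : (i : ℕ) < m)
  refine ⟨div_pos (by linarith) (by positivity), ?_⟩
  simp only [contract]
  rw [div_lt_iff₀ (by positivity)]
  linarith

/-- A point has a digit keeping it at least `η` away from the end points. -/
theorem exists_digit_mem_Icc (hd : 3 ≤ d) (hm : d ≤ m) {η : ℝ} (h0 : 0 ≤ η)
    (h1 : η ≤ 1 / (2 * d)) {y : ℝ} (hy : y ∈ Set.Icc η (rightEnd d m - η)) :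
    ∃ i : Fin (m + 1), (d : ℝ) * y - ((i : ℕ) : ℝ) ∈ Set.Icc η (rightEnd d m - η) := by
  have h3 : (3 : ℝ) ≤ d := by exact_mod_cast hd
  have h6 := rightEnd_eq (m := m) hd
  have h7 := one_add_inv_lt_rightEnd hd hm
  have h8 : 1 / (2 * (d : ℝ)) = 1 / d / 2 := by field_simp
  obtain ⟨hy1, hy2⟩ := hy
  have hnn : 0 ≤ (d : ℝ) * y - η := by nlinarith
  -- The digit ⌊dy-η⌋ leaves a remainder in [η, 1+η), and 1+η ≤ R-η because 2η ≤ 1/d. If the floor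
  -- exceeds m, the last digit works.
  by_cases h : ⌊(d : ℝ) * y - η⌋₊ ≤ m
  · refine ⟨⟨⌊(d : ℝ) * y - η⌋₊, by omega⟩, ?_, ?_⟩
    · have := Nat.floor_le hnn
      dsimp only
      linarith
    · have := Nat.lt_floor_add_one ((d : ℝ) * y - η)
      dsimp only
      linarith
  · refine ⟨Fin.last m, ?_, ?_⟩
    · have h2 : (m : ℝ) ≤ (d : ℝ) * y - η :=
        (Nat.cast_le.mpr (by omega : m ≤ ⌊(d : ℝ) * y - η⌋₊)).trans (Nat.floor_le hnn)
      rw [Fin.val_last]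
      linarith
    · rw [Fin.val_last]
      nlinarith

theorem exists_word_mem_Icc (hd : 3 ≤ d) (hm : d ≤ m) {η : ℝ} (h0 : 0 ≤ η)
    (h1 : η ≤ 1 / (2 * d)) (n : ℕ) {x : ℝ} (hx : x ∈ Set.Icc η (rightEnd d m - η)) :
    ∃ σ : List (Fin (m + 1)), σ.length = n ∧ ∃ y ∈ Set.Icc η (rightEnd d m - η),
      x = contract d σ y := by
  induction n generalizing x with
  | zero => exact ⟨[], rfl, x, hx, rfl⟩
  | succ n ih =>
    obtain ⟨i, hi⟩ := exists_digit_mem_Icc hd hm h0 h1 hx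
    obtain ⟨σ, hσ, y, hy, hxy⟩ := ih hi
    refine ⟨i :: σ, by simp [hσ], y, hy, ?_⟩
    simp only [contract, ← hxy]
    field_simp
    ring

/-- Near an end point the digit 0 or m multiplies the distance to that end point by d, so finitely
many repetitions bring the point into the central zone, where `exists_mid_digit` applies. -/
theorem exists_word_central (hd : 3 ≤ d) (hm : d ≤ m) {x : ℝ}
    (hx : x ∈ Set.Ioo 0 (rightEnd d m)) : ∃ u : List (Fin (m + 1)), ∃ z : ℝ,
      1 / (d : ℝ) < z ∧ z < rightEnd d m - 1 / d ∧ x = contract d u z := by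
  have h3 : (3 : ℝ) ≤ d := by exact_mod_cast hd
  have hc := one_add_inv_lt_rightEnd hd hm
  have he := rightEnd_eq (m := m) hd
  have hd1 : 1 / (d : ℝ) ≤ 1 / 3 := one_div_le_one_div_of_le (by norm_num) h3
  have hdd : (d : ℝ) * (1 / d) = 1 := by field_simp
  have hsmall : ∀ t : ℝ, 0 < t → ∃ N : ℕ, 1 / (d : ℝ) ^ (N + 1) < t := fun t ht => by
    obtain ⟨N, hN⟩ := exists_pow_lt_of_lt_one ht (by linarith : 1 / (d : ℝ) < 1)
    refine ⟨N, lt_of_le_of_lt ?_ hN⟩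
    rw [one_div_pow]
    exact one_div_le_one_div_of_le (by positivity) (pow_le_pow_right₀ (by linarith) (by omega))
  have left : ∀ N : ℕ, ∀ x : ℝ, 1 / (d : ℝ) ^ (N + 1) < x → x < rightEnd d m - 1 / d →
      ∃ u : List (Fin (m + 1)), ∃ z : ℝ,
      1 / (d : ℝ) < z ∧ z < rightEnd d m - 1 / d ∧ x = contract d u z := by
    intro N
    induction N with
    | zero => intro x h1 h2; exact ⟨[], x, by simpa using h1, h2, rfl⟩
    | succ N ih =>
      intro x h1 h2
      by_cases h : 1 / (d : ℝ) < x
      · exact ⟨[], x, h, h2, rfl⟩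
      · push Not at h
        have h4 : 1 / (d : ℝ) ^ (N + 1) < d * x := by
          have h5 : 1 / (d : ℝ) ^ (N + 1) = d * (1 / (d : ℝ) ^ (N + 1 + 1)) := by
            rw [pow_succ _ (N + 1)]; field_simp
          rw [h5]
          exact mul_lt_mul_of_pos_left h1 (by linarith)
        obtain ⟨u, z, hz1, hz2, hz3⟩ := ih (d * x) h4 (by nlinarith)
        refine ⟨0 :: u, z, hz1, hz2, ?_⟩
        simp only [contract, ← hz3, Fin.val_zero, Nat.cast_zero]
        field_simp
        ring
  have right : ∀ N : ℕ, ∀ x : ℝ, 1 / (d : ℝ) ^ (N + 1) < rightEnd d m - x → 1 / (d : ℝ) < x →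
      ∃ u : List (Fin (m + 1)), ∃ z : ℝ,
      1 / (d : ℝ) < z ∧ z < rightEnd d m - 1 / d ∧ x = contract d u z := by
    intro N
    induction N with
    | zero => intro x h1 h2; exact ⟨[], x, h2, by rw [zero_add, pow_one] at h1; linarith, rfl⟩
    | succ N ih =>
      intro x h1 h2
      by_cases h : x < rightEnd d m - 1 / d
      · exact ⟨[], x, h2, h, rfl⟩
      · push Not at h
        have h4 : 1 / (d : ℝ) ^ (N + 1) < rightEnd d m - (d * x - m) := by
          have h5 : 1 / (d : ℝ) ^ (N + 1) = d * (1 / (d : ℝ) ^ (N + 1 + 1)) := by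
            rw [pow_succ _ (N + 1)]; field_simp
          have h6 : rightEnd d m - (d * x - m) = d * (rightEnd d m - x) := by linarith
          rw [h5, h6]
          exact mul_lt_mul_of_pos_left h1 (by linarith)
        obtain ⟨u, z, hz1, hz2, hz3⟩ := ih (d * x - m) h4 (by nlinarith)
        refine ⟨Fin.last m :: u, z, hz1, hz2, ?_⟩
        simp only [contract, ← hz3, Fin.val_last]
        field_simp
        ring
  obtain ⟨hx0, hx1⟩ := hx
  by_cases h : x < rightEnd d m - 1 / d
  · obtain ⟨N, hN⟩ := hsmall x hx0
    exact left N x hN h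
  · obtain ⟨N, hN⟩ := hsmall (rightEnd d m - x) (by linarith)
    exact right N x hN (by linarith)

theorem exists_mid_digit (hd : 3 ≤ d) (hm : d ≤ m) {z : ℝ} (h1 : 1 / (d : ℝ) < z)
    (h2 : z < rightEnd d m - 1 / d) : ∃ i : Fin (m + 1), i ≠ 0 ∧ i ≠ Fin.last m ∧
      (d : ℝ) * z - ((i : ℕ) : ℝ) ∈ Set.Ioo 0 (rightEnd d m) := by
  have h3 : (3 : ℝ) ≤ d := by exact_mod_cast hd
  have hc := one_lt_rightEnd hd hm
  have he := rightEnd_eq (m := m) hd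
  have hdd : (d : ℝ) * (1 / d) = 1 := by field_simp
  have h4 : 1 < (d : ℝ) * z := by nlinarith
  have h5 : (d : ℝ) * z < rightEnd d m + m - 1 := by nlinarith
  have h6 : 2 ≤ ⌈(d : ℝ) * z⌉₊ := by
    have : 1 < ⌈(d : ℝ) * z⌉₊ := Nat.lt_ceil.mpr (by exact_mod_cast h4)
    omega
  -- The digit ⌈dz⌉-1 leaves a remainder in (0, 1]; the ceiling, not the floor, keeps it strictly
  -- positive, so that the remaining point is again interior. Beyond range, the digit m-1 works
  -- because dz < R+m-1.
  by_cases h : ⌈(d : ℝ) * z⌉₊ ≤ m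
  · obtain ⟨c, hcc⟩ : ∃ c, ⌈(d : ℝ) * z⌉₊ = c + 1 := ⟨⌈(d : ℝ) * z⌉₊ - 1, by omega⟩
    refine ⟨⟨c, by omega⟩, fun h0 => ?_, fun h0 => ?_, ?_, ?_⟩
    · have := congrArg Fin.val h0
      simp only [Fin.val_zero] at this
      omega
    · have := congrArg Fin.val h0
      simp only [Fin.val_last] at this
      omega
    · have : (c : ℝ) < d * z := Nat.lt_ceil.mp (by omega)
      dsimp only
      linarith
    · have := Nat.le_ceil ((d : ℝ) * z)
      rw [hcc] at this
      push_cast at this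
      dsimp only
      linarith
  · obtain ⟨c, rfl⟩ : ∃ c, m = c + 1 := ⟨m - 1, by omega⟩
    refine ⟨⟨c, by omega⟩, fun h0 => ?_, fun h0 => ?_, ?_, ?_⟩
    · have := congrArg Fin.val h0
      simp only [Fin.val_zero] at this
      omega
    · have := congrArg Fin.val h0
      simp only [Fin.val_last] at this
      omega
    · have : (c : ℝ) < d * z := Nat.lt_ceil.mp (by omega)
      dsimp only
      linarith
    · push_cast at h5
      dsimp only
      linarith

/-- The remaining point y is again interior, so the lemma can be iterated to produce arbitrarily
many middle digits. -/
theorem exists_word_mid (hd : 3 ≤ d) (hm : d ≤ m) {x : ℝ}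
    (hx : x ∈ Set.Ioo 0 (rightEnd d m)) : ∃ u : List (Fin (m + 1)), ∃ i : Fin (m + 1),
      i ≠ 0 ∧ i ≠ Fin.last m ∧ ∃ y ∈ Set.Ioo 0 (rightEnd d m), x = contract d (u ++ [i]) y := by
  obtain ⟨u, z, hz1, hz2, hz3⟩ := exists_word_central hd hm hx
  obtain ⟨i, hi1, hi2, hi3⟩ := exists_mid_digit hd hm hz1 hz2
  refine ⟨u, i, hi1, hi2, _, hi3, ?_⟩
  rw [contract_append, hz3]
  congr 1
  simp only [contract]
  field_simp
  ring

/-- The fixed point of a word starting with a middle digit is an interior point. -/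
theorem exists_fixed_point (hd : 3 ≤ d) (hm : d ≤ m) {i : Fin (m + 1)} (hi0 : i ≠ 0)
    (him : i ≠ Fin.last m) (σ : List (Fin (m + 1))) :
    ∃ x ∈ Set.Ioo 0 (rightEnd d m), contract d (i :: σ) x = x := by
  have h3 : (3 : ℝ) ≤ d := by exact_mod_cast hd
  have hc := one_lt_rightEnd hd hm
  have hD : 1 < (d : ℝ) ^ (i :: σ).length := one_lt_pow₀ (by linarith) (by simp)
  set D := (d : ℝ) ^ (i :: σ).length with hDdef
  have h0 := contract_mem_Ioo hd hi0 him σ (y := 0) ⟨le_rfl, by linarith⟩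
  have h1 := contract_mem_Ioo hd hi0 him σ (y := rightEnd d m) ⟨by linarith, le_rfl⟩
  set b := contract d (i :: σ) 0
  have h2 : ∀ y, contract d (i :: σ) y = b + y / D := fun y => by
    have := contract_sub hd (i :: σ) y 0
    rw [sub_zero] at this
    linarith
  have hD1 : D - 1 ≠ 0 := by linarith
  refine ⟨b * D / (D - 1), ⟨div_pos (mul_pos h0.1 (by linarith)) (by linarith), ?_⟩, ?_⟩
  · rw [div_lt_iff₀ (by linarith)]
    have h4 := h1.2
    rw [h2, ← sub_pos] at h4
    have h5 := mul_pos h4 (by linarith : 0 < D)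
    have h6 : (rightEnd d m - (b + rightEnd d m / D)) * D =
        rightEnd d m * (D - 1) - b * D := by
      have : D ≠ 0 := by linarith
      field_simp
      ring
    linarith
  · rw [h2]
    have : D ≠ 0 := by linarith
    field_simp
    ring

end Words

/-! ### The self-similar measure: support, cylinder masses, end points -/

section Measures

variable {d m : ℕ} {p : Fin (m + 1) → ℝ} {μ : Measure ℝ}

theorem IsSelfSimilar.real_eq (hμ : IsSelfSimilar d p μ) (hp : ∀ i, 0 < p i) {A : Set ℝ}
    (hA : MeasurableSet A) : μ.real A =
      ∑ i : Fin (m + 1), p i * μ.real {x | x / (d : ℝ) + ((i : ℕ) : ℝ) / (d : ℝ) ∈ A} := by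
  have := hμ.isProb
  have h : μ A = ∑ i : Fin (m + 1), ENNReal.ofReal (p i) *
      μ {x | x / (d : ℝ) + ((i : ℕ) : ℝ) / (d : ℝ) ∈ A} := by
    conv_lhs => rw [hμ.self_similar]
    simp only [Measure.coe_finsetSum, Measure.coe_smul, Finset.sum_apply, Pi.smul_apply,
      smul_eq_mul]
    refine Finset.sum_congr rfl fun i _ => ?_
    rw [Measure.map_apply (by fun_prop) hA]
    rfl
  rw [measureReal_def, h, ENNReal.toReal_sum]
  · refine Finset.sum_congr rfl fun i _ => ?_
    rw [ENNReal.toReal_mul, ENNReal.toReal_ofReal (hp i).le, measureReal_def]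
  · intro i _
    exact ENNReal.mul_ne_top ENNReal.ofReal_ne_top (measure_ne_top _ _)

/-- If the least point a of the support were negative, then a < a/d, so the half-line left of a/d
would have positive mass. By self-similarity that mass comes from points x < a-i with i ≥ 0, which
are off the support. The right end is symmetric. -/
theorem IsSelfSimilar.support_subset (hμ : IsSelfSimilar d p μ) (hd : 3 ≤ d)
    (hp : ∀ i, 0 < p i) : μ.support ⊆ Set.Icc 0 (rightEnd d m) := by
  have := hμ.isProb
  have h3 : (3 : ℝ) ≤ d := by exact_mod_cast hd
  have he := rightEnd_eq (m := m) hd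
  have hne : μ.support.Nonempty := Measure.nonempty_support (IsProbabilityMeasure.ne_zero μ)
  have hnull : μ.real μ.supportᶜ = 0 := by
    rw [measureReal_def, Measure.measure_compl_support, ENNReal.toReal_zero]
  have hpos : ∀ x ∈ μ.support, ∀ U : Set ℝ, IsOpen U → x ∈ U → 0 < μ.real U :=
    fun x hx U hU hxU => by
      rw [measureReal_def, ENNReal.toReal_pos_iff]
      exact ⟨(Measure.mem_support_iff_forall x).mp hx U (hU.mem_nhds hxU), measure_lt_top _ _⟩
  have hbot := hμ.compact_support.sInf_mem hne
  have htop := hμ.compact_support.sSup_mem hne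
  set a := sInf μ.support
  set b := sSup μ.support
  have hle : ∀ x ∈ μ.support, a ≤ x ∧ x ≤ b := fun x hx =>
    ⟨csInf_le hμ.compact_support.bddBelow hx, le_csSup hμ.compact_support.bddAbove hx⟩
  have hzero : ∀ E : Set ℝ, E ⊆ μ.supportᶜ → μ.real E = 0 := fun E hE =>
    le_antisymm ((measureReal_mono hE).trans hnull.le) measureReal_nonneg
  have ha : 0 ≤ a := by
    by_contra hlt
    push Not at hlt
    have h1 := hpos a hbot (Set.Iio (a / d)) isOpen_Iio (by
      rw [Set.mem_Iio, lt_div_iff₀ (by linarith)]; nlinarith)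
    rw [hμ.real_eq hp measurableSet_Iio, Finset.sum_eq_zero] at h1
    · exact lt_irrefl _ h1
    · intro i _
      rw [hzero, mul_zero]
      intro x hx hxs
      rw [Set.mem_ofPred_eq, Set.mem_Iio, ← add_div, div_lt_div_iff_of_pos_right (by linarith)] at hx
      have h4 : (0 : ℝ) ≤ ((i : ℕ) : ℝ) := by positivity
      linarith [(hle x hxs).1]
  have hb : b ≤ rightEnd d m := by
    by_contra hlt
    push Not at hlt
    have h1 := hpos b htop (Set.Ioi ((b + m) / d)) isOpen_Ioi (by
      rw [Set.mem_Ioi, div_lt_iff₀ (by linarith)]; nlinarith)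
    rw [hμ.real_eq hp measurableSet_Ioi, Finset.sum_eq_zero] at h1
    · exact lt_irrefl _ h1
    · intro i _
      rw [hzero, mul_zero]
      intro x hx hxs
      rw [Set.mem_ofPred_eq, Set.mem_Ioi, ← add_div, div_lt_div_iff_of_pos_right (by linarith)] at hx
      have h4 := digit_le i
      linarith [(hle x hxs).2]
  exact fun x hx => ⟨ha.trans (hle x hx).1, (hle x hx).2.trans hb⟩

theorem IsSelfSimilar.real_eq_zero (hμ : IsSelfSimilar d p μ) (hd : 3 ≤ d)
    (hp : ∀ i, 0 < p i) {E : Set ℝ} (hE : Disjoint E (Set.Icc 0 (rightEnd d m))) :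
    μ.real E = 0 := by
  have := hμ.isProb
  have hnull : μ.real μ.supportᶜ = 0 := by
    rw [measureReal_def, Measure.measure_compl_support, ENNReal.toReal_zero]
  refine le_antisymm ((measureReal_mono fun x hx hxs => ?_).trans hnull.le) measureReal_nonneg
  exact hE.le_bot ⟨hx, hμ.support_subset hd hp hxs⟩

theorem IsSelfSimilar.real_Icc (hμ : IsSelfSimilar d p μ) (hd : 3 ≤ d)
    (hp : ∀ i, 0 < p i) : μ.real (Set.Icc 0 (rightEnd d m)) = 1 := by
  have := hμ.isProb
  have h := hμ.real_eq_zero hd hp (E := (Set.Icc 0 (rightEnd d m))ᶜ) disjoint_compl_left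
  rw [probReal_compl_eq_one_sub measurableSet_Icc] at h
  linarith

/-- Only the branch of the self-similarity relation that follows σ is kept at each letter. -/
theorem IsSelfSimilar.pow_mul_real_le (hμ : IsSelfSimilar d p μ) (hd : 3 ≤ d)
    (hp : ∀ i, 0 < p i) (hmin : ∀ i, p 0 ≤ p i) {A : Set ℝ} (hA : MeasurableSet A)
    (σ : List (Fin (m + 1))) :
    p 0 ^ σ.length * μ.real A ≤ μ.real (expand d σ ⁻¹' A) := by
  have hd0 : (d : ℝ) ≠ 0 := by positivity
  induction σ with
  | nil => simp [expand]
  | cons i σ ih =>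
    rw [hμ.real_eq hp (measurable_expand _ hA)]
    have h1 : {x : ℝ | x / (d : ℝ) + ((i : ℕ) : ℝ) / (d : ℝ) ∈ expand d (i :: σ) ⁻¹' A} =
        expand d σ ⁻¹' A := by
      ext x
      simp only [Set.mem_ofPred_eq, Set.mem_preimage, expand]
      have : (d : ℝ) * (x / d + ((i : ℕ) : ℝ) / d) - ((i : ℕ) : ℝ) = x := by field_simp; ring
      rw [this]
    have h2 := Finset.single_le_sum
      (f := fun j : Fin (m + 1) => p j *
        μ.real {x | x / (d : ℝ) + ((j : ℕ) : ℝ) / (d : ℝ) ∈ expand d (i :: σ) ⁻¹' A})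
      (fun j _ => mul_nonneg (hp j).le measureReal_nonneg) (Finset.mem_univ i)
    refine le_trans ?_ h2
    rw [h1, List.length_cons, pow_succ, mul_comm (p 0 ^ _), mul_assoc]
    exact mul_le_mul (hmin i) ih (mul_nonneg (pow_nonneg (hp 0).le _) measureReal_nonneg) (hp i).le

theorem mem_ball_contract (hd : 3 ≤ d) (σ : List (Fin (m + 1))) (y z ε : ℝ) :
    z ∈ Metric.ball (contract d σ y) (ε / (d : ℝ) ^ σ.length) ↔
      expand d σ z ∈ Metric.ball y ε := by
  have hD : 0 < (d : ℝ) ^ σ.length := by positivity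
  rw [Metric.mem_ball, Metric.mem_ball, Real.dist_eq, Real.dist_eq, expand_sub hd, abs_mul,
    abs_of_pos hD, lt_div_iff₀ hD, mul_comm]

theorem IsSelfSimilar.pow_le_real_ball (hμ : IsSelfSimilar d p μ) (hd : 3 ≤ d) (hm : d ≤ m)
    (hp : ∀ i, 0 < p i) (hmin : ∀ i, p 0 ≤ p i) {x : ℝ} (hx : x ∈ Set.Icc 0 (rightEnd d m))
    (n : ℕ) : p 0 ^ n ≤ μ.real (Metric.ball x ((rightEnd d m + 1) / (d : ℝ) ^ n)) := by
  have := hμ.isProb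
  obtain ⟨σ, rfl, y, hy, rfl⟩ := exists_word_mem_Icc hd hm le_rfl (by positivity) n
    (x := x) (by simpa using hx)
  have h := hμ.pow_mul_real_le hd hp hmin (A := Set.Icc 0 (rightEnd d m)) measurableSet_Icc σ
  rw [hμ.real_Icc hd hp, mul_one] at h
  refine h.trans (measureReal_mono fun z hz => ?_)
  rw [mem_ball_contract hd, Metric.mem_ball, Real.dist_eq, abs_lt]
  obtain ⟨h1, h2⟩ := hz
  rw [sub_zero] at hy
  constructor <;> linarith [hy.1, hy.2]

theorem IsSelfSimilar.real_ball_pos (hμ : IsSelfSimilar d p μ) (hd : 3 ≤ d) (hm : d ≤ m)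
    (hp : ∀ i, 0 < p i) (hmin : ∀ i, p 0 ≤ p i) {x : ℝ} (hx : x ∈ Set.Icc 0 (rightEnd d m))
    {r : ℝ} (hr : 0 < r) : 0 < μ.real (Metric.ball x r) := by
  have := hμ.isProb
  have h3 : (3 : ℝ) ≤ d := by exact_mod_cast hd
  obtain ⟨n, hn⟩ := pow_unbounded_of_one_lt ((rightEnd d m + 1) / r) (by linarith : 1 < (d : ℝ))
  refine lt_of_lt_of_le (pow_pos (hp 0) n) ((hμ.pow_le_real_ball hd hm hp hmin hx n).trans
    (measureReal_mono (Metric.ball_subset_ball ?_)))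
  rw [div_lt_iff₀ hr] at hn
  rw [div_le_iff₀ (by positivity)]
  linarith

theorem IsSelfSimilar.support_eq (hμ : IsSelfSimilar d p μ) (hd : 3 ≤ d) (hm : d ≤ m)
    (hp : ∀ i, 0 < p i) (hmin : ∀ i, p 0 ≤ p i) : μ.support = Set.Icc 0 (rightEnd d m) := by
  refine Set.Subset.antisymm (hμ.support_subset hd hp) fun x hx => ?_
  rw [Measure.mem_support_iff_forall]
  intro U hU
  obtain ⟨r, hr, hrU⟩ := Metric.mem_nhds_iff.mp hU
  have h := hμ.real_ball_pos hd hm hp hmin hx hr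
  rw [measureReal_def, ENNReal.toReal_pos_iff] at h
  exact h.1.trans_le (measure_mono hrU)

/-- Both sides equal the sum of p_{k-t} g(k) over all integers k, where t = ld-i: the weights vanish
off [t, t+m] and g vanishes off the band. -/
theorem sum_digits_eq_sum_band (i : Fin (m + 1)) (l : Idx d m)
    {g : ℤ → ℝ} (hg : ∀ k : ℤ, k ∉ Finset.Icc (-(bandwidth d m : ℤ)) (bandwidth d m : ℤ) →
      g k = 0) :
    ∑ j : Fin (m + 1), p j * g (((j : ℕ) : ℤ) + (l : ℤ) * d - ((i : ℕ) : ℤ)) =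
      ∑ k : Idx d m, transfer d p i k l * g k := by
  set t : ℤ := (l : ℤ) * d - ((i : ℕ) : ℤ) with ht
  have h1 : ∑ j : Fin (m + 1), p j * g (((j : ℕ) : ℤ) + (l : ℤ) * d - ((i : ℕ) : ℤ)) =
      ∑ k ∈ Finset.Icc t (t + m), extWeight p (k - t) * g k := by
    refine Finset.sum_bij (fun j _ => ((j : ℕ) : ℤ) + t) (fun j _ => ?_) (fun j _ j' _ h => ?_)
      (fun k hk => ?_) (fun j _ => ?_)
    · have := j.2
      rw [Finset.mem_Icc]
      omega
    · exact Fin.ext (by omega)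
    · rw [Finset.mem_Icc] at hk
      exact ⟨⟨(k - t).toNat, by omega⟩, Finset.mem_univ _, by dsimp only; omega⟩
    · rw [add_sub_cancel_right, extWeight_val, ht]
      congr 2
      ring
  have h2 : ∑ k : Idx d m, transfer d p i k l * g k =
      ∑ k ∈ Finset.Icc (-(bandwidth d m : ℤ)) (bandwidth d m : ℤ), extWeight p (k - t) * g k := by
    rw [← Finset.sum_coe_sort _ (fun k : ℤ => extWeight p (k - t) * g k)]
    refine Finset.sum_congr rfl fun k _ => ?_
    rw [transfer_apply, ht]
    congr 2
    ring
  rw [h1, h2]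
  have h3 : ∀ F : Finset ℤ, (∀ k ∉ F, extWeight p (k - t) * g k = 0) →
      ∑ k ∈ F, extWeight p (k - t) * g k = ∑ k ∈ Finset.Icc t (t + m) ∪
        Finset.Icc (-(bandwidth d m : ℤ)) (bandwidth d m : ℤ) ∪ F,
          extWeight p (k - t) * g k := fun F hF =>
    Finset.sum_subset Finset.subset_union_right fun k _ hk => hF k hk
  have h4 := h3 (Finset.Icc t (t + m)) fun k hk => by
    rw [extWeight_eq_zero p, zero_mul]
    rw [Finset.mem_Icc] at hk
    omega
  have h5 := h3 (Finset.Icc (-(bandwidth d m : ℤ)) (bandwidth d m : ℤ)) fun k hk => by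
    rw [hg k hk, mul_zero]
  rw [h4, h5]
  refine Finset.sum_congr ?_ fun _ _ => rfl
  ext k
  simp only [Finset.mem_union]
  tauto

theorem le_bandwidth_succ (hd : 3 ≤ d) (hm : d ≤ m) :
    rightEnd d m ≤ (bandwidth d m : ℝ) + 1 := by
  have h3 : (3 : ℝ) ≤ d := by exact_mod_cast hd
  have h := le_mul_bandwidth_succ hd hm
  have h' : (m : ℝ) ≤ ((d : ℝ) - 1) * ((bandwidth d m : ℝ) + 1) := by exact_mod_cast h
  unfold rightEnd
  rw [div_le_iff₀ (by linarith)]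
  linarith

theorem bandwidth_lt_rightEnd (hd : 3 ≤ d) (hm : d ≤ m) :
    (bandwidth d m : ℝ) < rightEnd d m := by
  have h3 : (3 : ℝ) ≤ d := by exact_mod_cast hd
  have h := mul_bandwidth_lt hd hm
  have h' : ((d : ℝ) - 1) * (bandwidth d m : ℝ) + 1 ≤ m := by exact_mod_cast h
  unfold rightEnd
  rw [lt_div_iff₀ (by linarith)]
  linarith

/-- The transfer identity: the masses of the translates of a cylinder are linear combinations,
with coefficients from the word matrix, of the masses of the translates of its base. -/
theorem IsSelfSimilar.real_cylinder (hμ : IsSelfSimilar d p μ) (hd : 3 ≤ d) (hm : d ≤ m)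
    (hp : ∀ i, 0 < p i) {A : Set ℝ} (hA : MeasurableSet A)
    (hA' : A ⊆ Set.Ioo 0 (rightEnd d m)) (σ : List (Fin (m + 1))) (l : Idx d m) :
    μ.real {z | expand d σ (z + ((l : ℤ) : ℝ)) ∈ A} =
      ∑ k, wordMatrix d p σ k l * μ.real {y | y + ((k : ℤ) : ℝ) ∈ A} := by
  have hd0 : (d : ℝ) ≠ 0 := by positivity
  induction σ generalizing l with
  | nil => simp [wordMatrix_nil, expand, Matrix.one_apply]
  | cons i σ ih =>
    set g : ℤ → ℝ := fun k => μ.real {y | expand d σ (y + (k : ℝ)) ∈ A} with hg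
    have hmeas : MeasurableSet {z | expand d (i :: σ) (z + ((l : ℤ) : ℝ)) ∈ A} :=
      ((measurable_expand (d := d) (i :: σ)).comp (measurable_add_const ((l : ℤ) : ℝ))) hA
    rw [hμ.real_eq hp hmeas]
    have h1 : ∀ j : Fin (m + 1), μ.real {x : ℝ | x / (d : ℝ) + ((j : ℕ) : ℝ) / (d : ℝ) ∈
        {z | expand d (i :: σ) (z + ((l : ℤ) : ℝ)) ∈ A}} =
        g (((j : ℕ) : ℤ) + (l : ℤ) * d - ((i : ℕ) : ℤ)) := fun j => by
      rw [hg]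
      dsimp only
      congr 1
      ext x
      simp only [Set.mem_ofPred_eq, expand]
      have : (d : ℝ) * (x / d + ((j : ℕ) : ℝ) / d + ((l : ℤ) : ℝ)) - ((i : ℕ) : ℝ) =
          x + ((((j : ℕ) : ℤ) + (l : ℤ) * d - ((i : ℕ) : ℤ) : ℤ) : ℝ) := by
        push_cast
        field_simp
        ring
      rw [this]
    simp only [h1]
    rw [sum_digits_eq_sum_band i l (g := g)]
    · have h2 : ∀ k : Idx d m, g k =
          ∑ k', wordMatrix d p σ k' k * μ.real {y | y + ((k' : ℤ) : ℝ) ∈ A} := fun k => ih k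
      simp only [h2, Finset.mul_sum]
      rw [Finset.sum_comm]
      refine Finset.sum_congr rfl fun k' _ => ?_
      rw [wordMatrix_cons, Matrix.mul_apply, Finset.sum_mul]
      exact Finset.sum_congr rfl fun k _ => by ring
    -- The set lies in the open interval (0, R) and R ≤ a+1, so a translate by |k| ≥ a+1 misses [0,
    -- R]. Openness matters: R = a+1 can occur, and a closed set could still touch an end point.
    · intro k hk
      refine hμ.real_eq_zero hd hp (Set.disjoint_left.mpr fun y hy hy' => hk ?_)
      have h3 := mem_Ioo_of_expand_mem hd σ (hA' hy)
      have h4 := le_bandwidth_succ hd hm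
      obtain ⟨h5, h6⟩ := h3
      obtain ⟨h7, h8⟩ := hy'
      have h9 : (k : ℝ) < (bandwidth d m : ℝ) + 1 := by linarith
      have h10 : -((bandwidth d m : ℝ) + 1) < (k : ℝ) := by linarith
      have h11 : k < (bandwidth d m : ℤ) + 1 := by exact_mod_cast h9
      have h12 : -((bandwidth d m : ℤ) + 1) < k := by exact_mod_cast h10
      rw [Finset.mem_Icc]
      omega

/-- Upper half of the comparison between balls and column 0: the base masses are at most 1. The
lower half is `IsSelfSimilar.exists_le_real_ball`. -/
theorem IsSelfSimilar.real_ball_le (hμ : IsSelfSimilar d p μ) (hd : 3 ≤ d) (hm : d ≤ m)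
    (hp : ∀ i, 0 < p i) (σ : List (Fin (m + 1))) {y ε : ℝ}
    (hy : Metric.ball y ε ⊆ Set.Ioo 0 (rightEnd d m)) :
    μ.real (Metric.ball (contract d σ y) (ε / (d : ℝ) ^ σ.length)) ≤
      ∑ k, wordMatrix d p σ k (zeroIdx d m) := by
  have := hμ.isProb
  have h := hμ.real_cylinder hd hm hp measurableSet_ball hy σ (zeroIdx d m)
  simp only [coe_zeroIdx, Int.cast_zero, add_zero] at h
  have h1 : Metric.ball (contract d σ y) (ε / (d : ℝ) ^ σ.length) =
      {z | expand d σ z ∈ Metric.ball y ε} := Set.ext fun z => mem_ball_contract hd σ y z ε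
  rw [h1, h]
  exact Finset.sum_le_sum fun k _ =>
    mul_le_of_le_one_right (wordMatrix_nonneg hp σ k _) measureReal_le_one

theorem IsSelfSimilar.exists_le_real_ball (hμ : IsSelfSimilar d p μ) (hd : 3 ≤ d) (hm : d ≤ m)
    (hp : ∀ i, 0 < p i) (hmin : ∀ i, p 0 ≤ p i) :
    ∃ c : ℝ, 0 < c ∧ ∀ (σ : List (Fin (m + 1))), ∀ y ∈ Set.Icc 0 (rightEnd d m),
      c * ∑ k, wordMatrix d p σ k (zeroIdx d m) ≤
        μ.real (Metric.ball (contract d σ y) ((rightEnd d m + 1) / (d : ℝ) ^ σ.length)) := by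
  have := hμ.isProb
  have hpos : ∀ k : Idx d m, 0 < μ.real {y | y + ((k : ℤ) : ℝ) ∈ Set.Ioo 0 (rightEnd d m)} := by
    intro k
    obtain ⟨h1, h2⟩ := idx_bounds k
    have h3 := bandwidth_lt_rightEnd hd hm
    have h4 : ((k : ℤ) : ℝ) ≤ (bandwidth d m : ℝ) := by exact_mod_cast h2
    have h5 : -(bandwidth d m : ℝ) ≤ ((k : ℤ) : ℝ) := by exact_mod_cast h1
    have h6 := one_lt_rightEnd hd hm
    set e : ℝ := ((k : ℤ) : ℝ)
    -- Since |k| ≤ a < R, the interval (0, R) overlaps its translate, so every base mass is positive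
    -- and finitely many of them have a positive minimum.
    have hx : max 0 (-e) < min (rightEnd d m) (rightEnd d m - e) :=
      max_lt (lt_min (by linarith) (by linarith)) (lt_min (by linarith) (by linarith))
    obtain ⟨x, hx1, hx2⟩ := exists_between hx
    rw [max_lt_iff] at hx1
    rw [lt_min_iff] at hx2
    have hopen : IsOpen {y : ℝ | y + e ∈ Set.Ioo 0 (rightEnd d m)} :=
      isOpen_Ioo.preimage (continuous_add_const e)
    obtain ⟨r, hr, hrU⟩ := Metric.isOpen_iff.mp hopen x ⟨by linarith, by linarith⟩
    exact (hμ.real_ball_pos hd hm hp hmin ⟨hx1.1.le, hx2.1.le⟩ hr).trans_le (measureReal_mono hrU)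
  obtain ⟨k0, -, hk0⟩ := Finset.exists_min_image Finset.univ
    (fun k : Idx d m => μ.real {y | y + ((k : ℤ) : ℝ) ∈ Set.Ioo 0 (rightEnd d m)})
    ⟨zeroIdx d m, Finset.mem_univ _⟩
  refine ⟨_, hpos k0, fun σ y hy => ?_⟩
  have h := hμ.real_cylinder hd hm hp measurableSet_Ioo subset_rfl σ (zeroIdx d m)
  simp only [coe_zeroIdx, Int.cast_zero, add_zero] at h
  have h1 : {z | expand d σ z ∈ Set.Ioo 0 (rightEnd d m)} ⊆
      Metric.ball (contract d σ y) ((rightEnd d m + 1) / (d : ℝ) ^ σ.length) := fun z hz => by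
    rw [mem_ball_contract hd, Metric.mem_ball, Real.dist_eq, abs_lt]
    obtain ⟨h1, h2⟩ := hz
    constructor <;> linarith [hy.1, hy.2]
  refine le_trans ?_ (measureReal_mono h1)
  rw [h, Finset.mul_sum]
  refine Finset.sum_le_sum fun k _ => ?_
  rw [mul_comm]
  exact mul_le_mul_of_nonneg_left (hk0 k (Finset.mem_univ k)) (wordMatrix_nonneg hp σ k _)

/-- Near the left end point only the digit zero contributes. -/
theorem IsSelfSimilar.real_ball_zero (hμ : IsSelfSimilar d p μ) (hd : 3 ≤ d)
    (hp : ∀ i, 0 < p i) (n : ℕ) :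
    μ.real (Metric.ball 0 (1 / (d : ℝ) ^ n)) = p 0 ^ n * μ.real (Metric.ball 0 1) := by
  have h3 : (3 : ℝ) ≤ d := by exact_mod_cast hd
  have := hμ.isProb
  induction n with
  | zero => simp
  | succ n ih =>
    rw [hμ.real_eq hp measurableSet_ball, Finset.sum_eq_single 0]
    · rw [pow_succ (p 0), mul_comm (p 0 ^ n), mul_assoc, ← ih]
      congr 2
      ext x
      simp only [Set.mem_ofPred_eq, Metric.mem_ball, Real.dist_eq, sub_zero, Fin.val_zero,
        Nat.cast_zero, zero_div, add_zero, abs_div, Nat.abs_cast]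
      rw [div_lt_iff₀ (by linarith)]
      have : 1 / (d : ℝ) ^ (n + 1) * d = 1 / (d : ℝ) ^ n := by rw [pow_succ]; field_simp
      rw [this]
    · intro i _ hi
      rw [hμ.real_eq_zero hd hp, mul_zero]
      refine Set.disjoint_left.mpr fun x hx hx' => ?_
      have h4 : (1 : ℝ) ≤ ((i : ℕ) : ℝ) := by
        have : (i : ℕ) ≠ 0 := fun h => hi (Fin.ext h)
        exact_mod_cast Nat.one_le_iff_ne_zero.mpr this
      rw [Set.mem_ofPred_eq, Metric.mem_ball, Real.dist_eq, sub_zero, abs_lt, ← add_div,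
        div_lt_iff₀ (by linarith)] at hx
      have : 1 / (d : ℝ) ^ (n + 1) * d = 1 / (d : ℝ) ^ n := by rw [pow_succ]; field_simp
      rw [this] at hx
      have h5 : 1 / (d : ℝ) ^ n ≤ 1 := by
        rw [div_le_one (by positivity)]
        exact one_le_pow₀ (by linarith)
      linarith [hx'.1, hx.2]
    · simp

/-- Near the right end point only the last digit contributes. -/
theorem IsSelfSimilar.real_ball_rightEnd (hμ : IsSelfSimilar d p μ) (hd : 3 ≤ d)
    (hp : ∀ i, 0 < p i) (n : ℕ) :
    μ.real (Metric.ball (rightEnd d m) (1 / (d : ℝ) ^ n)) =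
      p (Fin.last m) ^ n * μ.real (Metric.ball (rightEnd d m) 1) := by
  have h3 : (3 : ℝ) ≤ d := by exact_mod_cast hd
  have he := rightEnd_eq (m := m) hd
  have := hμ.isProb
  induction n with
  | zero => simp
  | succ n ih =>
    have hr : 1 / (d : ℝ) ^ (n + 1) * d = 1 / (d : ℝ) ^ n := by rw [pow_succ]; field_simp
    have hball : ∀ (x : ℝ) (i : Fin (m + 1)), x / (d : ℝ) + ((i : ℕ) : ℝ) / d ∈
        Metric.ball (rightEnd d m) (1 / (d : ℝ) ^ (n + 1)) ↔
        |x + ((i : ℕ) : ℝ) - m - rightEnd d m| < 1 / (d : ℝ) ^ n := fun x i => by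
      have h1 : x / (d : ℝ) + ((i : ℕ) : ℝ) / d - rightEnd d m =
          (x + ((i : ℕ) : ℝ) - m - rightEnd d m) / d := by
        field_simp
        linarith
      rw [Metric.mem_ball, Real.dist_eq, h1, abs_div, Nat.abs_cast, div_lt_iff₀ (by linarith), hr]
    rw [hμ.real_eq hp measurableSet_ball, Finset.sum_eq_single (Fin.last m)]
    · rw [pow_succ (p (Fin.last m)), mul_comm (p (Fin.last m) ^ n), mul_assoc, ← ih]
      congr 2
      ext x
      rw [Set.mem_ofPred_eq, hball, Fin.val_last, Metric.mem_ball, Real.dist_eq,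
        add_sub_cancel_right]
    · intro i _ hi
      rw [hμ.real_eq_zero hd hp, mul_zero]
      refine Set.disjoint_left.mpr fun x hx hx' => ?_
      have h4 : ((i : ℕ) : ℝ) + 1 ≤ m := by
        have h5 : (i : ℕ) ≠ m := fun h => hi (Fin.ext h)
        have h6 := i.2
        exact_mod_cast (by omega : (i : ℕ) + 1 ≤ m)
      rw [Set.mem_ofPred_eq, hball, abs_lt] at hx
      have h5 : 1 / (d : ℝ) ^ n ≤ 1 := by
        rw [div_le_one (by positivity)]
        exact one_le_pow₀ (by linarith)
      linarith [hx'.2, hx.1]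
    · simp

end Measures

/-! ### Local dimensions from bounds along a geometric sequence of radii -/

section LocalDimension

variable {μ : Measure ℝ} {x : ℝ}

theorem log_measure_div_log_eq [IsProbabilityMeasure μ] {r : ℝ}
    (h : 0 < μ.real (Metric.ball x r)) :
    ENNReal.log (μ (Metric.ball x r)) / (Real.log r : EReal) =
      ((Real.log (μ.real (Metric.ball x r)) / Real.log r : ℝ) : EReal) := by
  rw [ENNReal.log_pos_real' h, EReal.coe_div]
  rfl

theorem tendsto_comparison (K G : ℝ) :
    Tendsto (fun r : ℝ => ((K / Real.log r + G : ℝ) : EReal)) (𝓝[>] 0) (𝓝 (G : EReal)) := by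
  rw [EReal.tendsto_coe]
  have h : Tendsto (fun r : ℝ => K / Real.log r) (𝓝[>] 0) (𝓝 0) :=
    tendsto_const_nhds.div_atBot Real.tendsto_log_nhdsGT_zero
  simpa using h.add_const G

/-- Each small r is compared with the radius C/D^j next below it. The base D is free because a
periodic word w calls for D = d^|w|. -/
theorem upperLocalDim_le [IsProbabilityMeasure μ] {D g C C' : ℝ} (hD : 1 < D) (hg : 0 < g)
    (hC : 0 < C) (hC' : 0 < C') (h : ∀ j : ℕ, C' * g ^ j ≤ μ.real (Metric.ball x (C / D ^ j))) :
    upperLocalDim μ x ≤ ((-1 / Real.log D * Real.log g : ℝ) : EReal) := by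
  have hL : 0 < Real.log D := Real.log_pos hD
  -- K collects the errors: the constant C', the rounding of the scale t to an integer, at most |log
  -- g|, and the shift of scale by C. They disappear after division by log r.
  set K : ℝ := Real.log C' - |Real.log g| + Real.log C * (Real.log g / Real.log D) with hK
  refine le_trans (limsup_le_limsup ?_) (tendsto_comparison K _).limsup_eq.le
  have hmem : Set.Ioo (0 : ℝ) (min C 1) ∈ 𝓝[>] (0 : ℝ) :=
    Ioo_mem_nhdsGT (lt_min hC one_pos)
  filter_upwards [hmem] with r hr
  obtain ⟨hr0, hr1⟩ := hr
  rw [lt_min_iff] at hr1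
  have hlr : Real.log r < 0 := Real.log_neg hr0 hr1.2
  set t : ℝ := Real.log (C / r) / Real.log D with ht
  have ht0 : 0 ≤ t := div_nonneg (Real.log_nonneg ((one_le_div hr0).mpr hr1.1.le)) hL.le
  have hj1 := Nat.le_ceil t
  have hj2 := (Nat.ceil_lt_add_one ht0).le
  set j := ⌈t⌉₊
  have hrad : C / D ^ j ≤ r := by
    have h1 : Real.log (C / r) ≤ Real.log (D ^ j) := by
      rw [Real.log_pow]
      rwa [ht, div_le_iff₀ hL] at hj1
    have h2 := (Real.log_le_log_iff (by positivity) (by positivity)).mp h1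
    rw [div_le_iff₀ hr0] at h2
    rw [div_le_iff₀ (by positivity)]
    linarith
  have hμ : C' * g ^ j ≤ μ.real (Metric.ball x r) :=
    (h j).trans (measureReal_mono (Metric.ball_subset_ball hrad))
  have hpos : 0 < C' * g ^ j := by positivity
  rw [log_measure_div_log_eq (hpos.trans_le hμ), EReal.coe_le_coe_iff, div_le_iff_of_neg hlr]
  have h3 := Real.log_le_log hpos hμ
  rw [Real.log_mul hC'.ne' (by positivity), Real.log_pow] at h3
  have h4 : t * Real.log g - |Real.log g| ≤ j * Real.log g := by
    have := neg_abs_le ((j - t) * Real.log g)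
    rw [abs_mul, abs_of_nonneg (by linarith : 0 ≤ (j : ℝ) - t)] at this
    nlinarith [abs_nonneg (Real.log g)]
  have h5 : (K / Real.log r + -1 / Real.log D * Real.log g) * Real.log r =
      Real.log C' - |Real.log g| + t * Real.log g := by
    rw [ht, Real.log_div hC.ne' hr0.ne', hK]
    have := hlr.ne
    field_simp
    ring
  rw [h5]
  linarith

/-- Mirror image with the radius next above r, hence the floor. Here positivity of all balls is a
hypothesis, since an upper bound on the mass does not make its logarithm finite. -/
theorem le_lowerLocalDim [IsProbabilityMeasure μ] {D g C C' : ℝ} (hD : 1 < D) (hg : 0 < g)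
    (hC : 0 < C) (hC' : 0 < C') (hx : ∀ r, 0 < r → 0 < μ.real (Metric.ball x r))
    (h : ∀ j : ℕ, μ.real (Metric.ball x (C / D ^ j)) ≤ C' * g ^ j) :
    ((-1 / Real.log D * Real.log g : ℝ) : EReal) ≤ lowerLocalDim μ x := by
  have hL : 0 < Real.log D := Real.log_pos hD
  set K : ℝ := Real.log C' + |Real.log g| + Real.log C * (Real.log g / Real.log D) with hK
  refine le_trans (tendsto_comparison K _).liminf_eq.ge (liminf_le_liminf ?_)
  have hmem : Set.Ioo (0 : ℝ) (min C 1) ∈ 𝓝[>] (0 : ℝ) :=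
    Ioo_mem_nhdsGT (lt_min hC one_pos)
  filter_upwards [hmem] with r hr
  obtain ⟨hr0, hr1⟩ := hr
  rw [lt_min_iff] at hr1
  have hlr : Real.log r < 0 := Real.log_neg hr0 hr1.2
  set t : ℝ := Real.log (C / r) / Real.log D with ht
  have ht0 : 0 ≤ t := div_nonneg (Real.log_nonneg ((one_le_div hr0).mpr hr1.1.le)) hL.le
  have hj1 := Nat.floor_le ht0
  have hj2 := (Nat.lt_floor_add_one t).le
  set j := ⌊t⌋₊
  have hrad : r ≤ C / D ^ j := by
    have h1 : Real.log (D ^ j) ≤ Real.log (C / r) := by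
      rw [Real.log_pow]
      rwa [ht, le_div_iff₀ hL] at hj1
    have h2 := (Real.log_le_log_iff (by positivity) (by positivity)).mp h1
    rw [le_div_iff₀ hr0] at h2
    rw [le_div_iff₀ (by positivity)]
    linarith
  have hμ : μ.real (Metric.ball x r) ≤ C' * g ^ j :=
    (measureReal_mono (Metric.ball_subset_ball hrad)).trans (h j)
  rw [log_measure_div_log_eq (hx r hr0), EReal.coe_le_coe_iff, le_div_iff_of_neg hlr]
  have h3 := Real.log_le_log (hx r hr0) hμ
  rw [Real.log_mul hC'.ne' (by positivity), Real.log_pow] at h3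
  have h4 : j * Real.log g ≤ t * Real.log g + |Real.log g| := by
    have := le_abs_self ((j - t) * Real.log g)
    rw [abs_mul, abs_of_nonpos (by linarith : (j : ℝ) - t ≤ 0)] at this
    nlinarith [abs_nonneg (Real.log g)]
  have h5 : (K / Real.log r + -1 / Real.log D * Real.log g) * Real.log r =
      Real.log C' + |Real.log g| + t * Real.log g := by
    rw [ht, Real.log_div hC.ne' hr0.ne', hK]
    have := hlr.ne
    field_simp
    ring
  rw [h5]
  linarith

theorem lowerLocalDim_le_upperLocalDim (μ : Measure ℝ) (x : ℝ) :
    lowerLocalDim μ x ≤ upperLocalDim μ x := liminf_le_limsup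

end LocalDimension

/-! ### Growth rates of words and the two spectral quantities -/

section Growth

variable {d m : ℕ} {p : Fin (m + 1) → ℝ}

theorem realRho_pow_le_entrySum {n : Type*} [Fintype n] [DecidableEq n] [Nonempty n]
    {A : Matrix n n ℝ} (hA : ∀ k l, 0 ≤ A k l) (j : ℕ) : realRho A ^ j ≤ entrySum (A ^ j) := by
  rcases Nat.eq_zero_or_pos j with rfl | hj
  · obtain ⟨k⟩ := ‹Nonempty n›
    have := entry_le_entrySum (pow_nonneg_entries hA 0) k k
    rw [pow_zero, pow_zero] at *
    simpa using this
  · exact (realRho_pow_le A hj.ne').trans (realRho_le_entrySum (pow_nonneg_entries hA j))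

theorem exists_entrySum_le_entry {n : Type*} [Fintype n] [Nonempty n]
    (A : Matrix n n ℝ) : ∃ k l, entrySum A ≤ (Fintype.card n : ℝ) ^ 2 * A k l := by
  obtain ⟨⟨k, l⟩, -, h⟩ := Finset.exists_max_image Finset.univ (fun x : n × n => A x.1 x.2)
    Finset.univ_nonempty
  refine ⟨k, l, ?_⟩
  have hsum : entrySum A = ∑ x : n × n, A x.1 x.2 :=
    (Fintype.sum_prod_type' (fun k l => A k l)).symm
  rw [hsum]
  refine (Finset.sum_le_card_nsmul _ _ (A k l) fun x hx => h x hx).trans (le_of_eq ?_)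
  rw [nsmul_eq_mul, Finset.card_univ, Fintype.card_prod]
  push_cast
  ring

theorem realRho_wordMatrix_pos (hp : ∀ i, 0 < p i) (hmin : ∀ i, p 0 ≤ p i)
    (σ : List (Fin (m + 1))) : 0 < realRho (wordMatrix d p σ) :=
  (wordMatrix_zero_zero_pos hp hmin σ).trans_le (diag_le_realRho (wordMatrix_nonneg hp σ) _)

/-- Words over the alphabet `{0, …, m}` grow at most exponentially. -/
theorem exists_entrySum_wordMatrix_le (hp : ∀ i, 0 < p i) :
    ∃ K B : ℝ, 1 ≤ K ∧ 1 ≤ B ∧ ∀ σ : List (Fin (m + 1)),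
      entrySum (wordMatrix d p σ) ≤ K * B ^ σ.length := by
  set B0 := ∑ i, entrySum (transfer d p i) with hB0
  have h0 : ∀ i, 0 ≤ entrySum (transfer d p i) := fun i => entrySum_nonneg (transfer_nonneg hp i)
  refine ⟨Fintype.card (Idx d m), B0 + 1, ?_, ?_, fun σ => ?_⟩
  · exact_mod_cast Nat.one_le_iff_ne_zero.mpr Fintype.card_ne_zero
  · linarith [Finset.sum_nonneg fun i (_ : i ∈ Finset.univ) => h0 i]
  · induction σ with
    | nil => simp [wordMatrix_nil, entrySum, Matrix.one_apply]
    | cons i σ ih =>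
      have h1 : entrySum (transfer d p i) ≤ B0 + 1 :=
        (Finset.single_le_sum (f := fun i => entrySum (transfer d p i)) (fun i _ => h0 i)
          (Finset.mem_univ i)).trans (by linarith)
      rw [wordMatrix_cons, List.length_cons, pow_succ, ← mul_assoc]
      exact (entrySum_mul_le (wordMatrix_nonneg hp σ) (transfer_nonneg hp i)).trans
        (mul_le_mul ih h1 (h0 i) ((entrySum_nonneg (wordMatrix_nonneg hp σ)).trans ih))

/-- Every word can be completed, by a bounded number of letters, to a word which begins with a
middle digit and whose matrix has a comparable entry at `(0, 0)`. -/
theorem exists_completion (hd : 3 ≤ d) (hm : d ≤ m) (hp : ∀ i, 0 < p i) :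
    ∃ c : ℝ, 0 < c ∧ ∃ E : ℕ, ∀ σ : List (Fin (m + 1)), ∃ i α θ, i ≠ 0 ∧ i ≠ Fin.last m ∧
      (i :: α).length + θ.length ≤ E ∧ c * entrySum (wordMatrix d p σ) ≤
        wordMatrix d p ((i :: α) ++ σ ++ θ) (zeroIdx d m) (zeroIdx d m) := by
  choose θ hθ using exists_wordMatrix_zero_pos (p := p) hd hm hp
  let i : Fin (m + 1) := ⟨1, by omega⟩
  have hi0 : i ≠ 0 := fun h => by
    have := congrArg Fin.val h
    simp [i] at this
  have him : i ≠ Fin.last m := fun h => by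
    have := congrArg Fin.val h
    simp only [i, Fin.val_last] at this
    omega
  -- Which letters follow the middle digit is irrelevant; a of them suffice to fill the band.
  let α : List (Fin (m + 1)) := List.replicate (bandwidth d m) 0
  have hα : ∀ l, 0 < wordMatrix d p (i :: α) l (zeroIdx d m) :=
    column_pos hd hm hp hi0 him (by simp [α])
  obtain ⟨k0, -, hk0⟩ := Finset.exists_min_image Finset.univ
    (fun k => wordMatrix d p (θ k) (zeroIdx d m) k) Finset.univ_nonempty
  obtain ⟨l0, -, hl0⟩ := Finset.exists_min_image Finset.univ
    (fun l => wordMatrix d p (i :: α) l (zeroIdx d m)) Finset.univ_nonempty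
  have hcard : (0 : ℝ) < (Fintype.card (Idx d m) : ℝ) ^ 2 := by
    have : 0 < Fintype.card (Idx d m) := Fintype.card_pos
    positivity
  set a := wordMatrix d p (θ k0) (zeroIdx d m) k0
  set b := wordMatrix d p (i :: α) l0 (zeroIdx d m)
  refine ⟨a * b / (Fintype.card (Idx d m) : ℝ) ^ 2,
    div_pos (mul_pos (hθ k0) (hα l0)) hcard, (i :: α).length + ∑ k, (θ k).length, fun σ => ?_⟩
  obtain ⟨k, l, hkl⟩ := exists_entrySum_le_entry (wordMatrix d p σ)
  refine ⟨i, α, θ k, hi0, him, Nat.add_le_add_left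
    (Finset.single_le_sum (f := fun k => (θ k).length) (fun _ _ => Nat.zero_le _)
      (Finset.mem_univ k)) _, ?_⟩
  have h1 := mul_le_wordMatrix_append hp (i :: α) σ k l (zeroIdx d m)
  have h2 := mul_le_wordMatrix_append hp ((i :: α) ++ σ) (θ k) (zeroIdx d m) k (zeroIdx d m)
  have hσ := wordMatrix_nonneg (d := d) hp σ k l
  calc a * b / (Fintype.card (Idx d m) : ℝ) ^ 2 * entrySum (wordMatrix d p σ)
      ≤ a * b / (Fintype.card (Idx d m) : ℝ) ^ 2 *
        ((Fintype.card (Idx d m) : ℝ) ^ 2 * wordMatrix d p σ k l) :=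
        mul_le_mul_of_nonneg_left hkl
          (div_nonneg (mul_nonneg (hθ k0).le (hα l0).le) hcard.le)
    _ = a * (wordMatrix d p σ k l * b) := by field_simp
    _ ≤ wordMatrix d p (θ k) (zeroIdx d m) k *
        (wordMatrix d p σ k l * wordMatrix d p (i :: α) l (zeroIdx d m)) :=
        mul_le_mul (hk0 k (Finset.mem_univ k))
          (mul_le_mul_of_nonneg_left (hl0 l (Finset.mem_univ l)) hσ)
          (mul_nonneg hσ (hα l0).le) (hθ k).le
    _ ≤ _ := (mul_le_mul_of_nonneg_left h1 (hθ k).le).trans h2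

/-- The generalized spectral radius of the transfer matrices as an extended real number. -/
noncomputable abbrev jointRho (d : ℕ) {m : ℕ} (p : Fin (m + 1) → ℝ) : ℝ≥0∞ :=
  genSpectralRadius (Set.range (transfer d p))

theorem exists_word_of_list {L : List (Matrix (Idx d m) (Idx d m) ℝ)}
    (hL : ∀ A ∈ L, A ∈ Set.range (transfer d p)) :
    ∃ σ : List (Fin (m + 1)), σ.length = L.length ∧ wordMatrix d p σ = L.prod := by
  have h : L ∈ Set.range (List.map (transfer d p)) := by
    rw [Set.range_list_map]
    exact hL
  obtain ⟨w, rfl⟩ := h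
  exact ⟨w.reverse, by simp, by simp [wordMatrix]⟩

theorem rho_wordMatrix_le_iSup (σ : List (Fin (m + 1))) : rho (wordMatrix d p σ) ≤
    ⨆ L ∈ {L : List (Matrix (Idx d m) (Idx d m) ℝ) | L.length = σ.length ∧
      ∀ A ∈ L, A ∈ Set.range (transfer d p)}, rho L.prod := by
  refine le_iSup₂_of_le (σ.map (transfer d p)).reverse ⟨by simp, fun A hA => ?_⟩ le_rfl
  rw [List.mem_reverse, List.mem_map] at hA
  obtain ⟨i, -, rfl⟩ := hA
  exact ⟨i, rfl⟩

/-- Repeating σ gives admissible products of the unbounded lengths (N+1)|σ| with at least the same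
normalised spectral radius, and a limsup is at least any value attained or exceeded infinitely
often. -/
theorem rho_rpow_le_jointRho {σ : List (Fin (m + 1))} (hσ : σ ≠ []) :
    rho (wordMatrix d p σ) ^ (1 / (σ.length : ℝ)) ≤ jointRho d p := by
  have hn : 0 < σ.length := List.length_pos_iff.mpr hσ
  refine le_limsup_of_frequently_le' (frequently_atTop.mpr fun N => ⟨(N + 1) * σ.length,
    by nlinarith, ?_⟩)
  have h1 := rho_wordMatrix_le_iSup (d := d) (p := p) (wordPow σ (N + 1))
  rw [length_wordPow, wordMatrix_wordPow] at h1
  have h2 := (rho_pow_le (wordMatrix d p σ) N.succ_ne_zero).trans h1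
  refine le_trans (le_of_eq ?_) (ENNReal.rpow_le_rpow h2 (by positivity))
  rw [← ENNReal.rpow_natCast, ← ENNReal.rpow_mul]
  congr 1
  have : (σ.length : ℝ) ≠ 0 := by positivity
  push_cast
  field_simp

theorem jointRho_ne_top (hp : ∀ i, 0 < p i) : jointRho d p ≠ ⊤ := by
  obtain ⟨K, B, hK, hB, h⟩ := exists_entrySum_wordMatrix_le (d := d) hp
  refine ne_top_of_le_ne_top (ENNReal.ofReal_ne_top (r := K * B)) ?_
  refine limsup_le_of_le (by isBoundedDefault) ?_
  filter_upwards [eventually_ge_atTop 1] with k hk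
  have hk' : (0 : ℝ) < k := by exact_mod_cast hk
  have h1 : (⨆ L ∈ {L : List (Matrix (Idx d m) (Idx d m) ℝ) | L.length = k ∧
      ∀ A ∈ L, A ∈ Set.range (transfer d p)}, rho L.prod) ≤ ENNReal.ofReal (K * B) ^ (k : ℝ) := by
    refine iSup₂_le fun L hL => ?_
    obtain ⟨σ, hσ1, hσ2⟩ := exists_word_of_list hL.2
    rw [← hσ2, ← ofReal_realRho, ENNReal.rpow_natCast, ← ENNReal.ofReal_pow (by positivity)]
    refine ENNReal.ofReal_le_ofReal ((realRho_le_entrySum (wordMatrix_nonneg hp σ)).trans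
      ((h σ).trans ?_))
    rw [hσ1, hL.1, mul_pow]
    exact mul_le_mul_of_nonneg_right (le_self_pow₀ hK (by omega)) (by positivity)
  refine (ENNReal.rpow_le_rpow h1 (by positivity)).trans (le_of_eq ?_)
  rw [← ENNReal.rpow_mul, mul_one_div, div_self hk'.ne', ENNReal.rpow_one]

/-- A word bounds the joint spectral radius from below. -/
theorem realRho_le_jointRho_pow (hp : ∀ i, 0 < p i) {σ : List (Fin (m + 1))} (hσ : σ ≠ []) :
    realRho (wordMatrix d p σ) ≤ (jointRho d p).toReal ^ σ.length := by
  have hn : 0 < σ.length := List.length_pos_iff.mpr hσ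
  have hn' : (σ.length : ℝ) ≠ 0 := by positivity
  have h := ENNReal.rpow_le_rpow (rho_rpow_le_jointRho (d := d) (p := p) hσ)
    (Nat.cast_nonneg (α := ℝ) σ.length)
  rw [← ENNReal.rpow_mul, one_div, inv_mul_cancel₀ hn', ENNReal.rpow_one,
    ENNReal.rpow_natCast] at h
  rw [← ENNReal.toReal_pow]
  exact ENNReal.toReal_mono (ENNReal.pow_ne_top (jointRho_ne_top hp)) h

theorem le_jointRho (hp : ∀ i, 0 < p i) (i : Fin (m + 1)) : p i ≤ (jointRho d p).toReal := by
  have h := realRho_le_jointRho_pow (d := d) hp (List.cons_ne_nil i [])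
  rw [wordMatrix_singleton, List.length_singleton, pow_one] at h
  rw [← transfer_zero_zero (d := d) (p := p) i]
  exact (diag_le_realRho (transfer_nonneg hp i) _).trans h

theorem exists_word_gt {s : ℝ} (hs0 : 0 ≤ s) (hs : s < (jointRho d p).toReal) (N : ℕ) :
    ∃ σ : List (Fin (m + 1)), N ≤ σ.length ∧ s ^ σ.length ≤ realRho (wordMatrix d p σ) := by
  have h1 : ENNReal.ofReal s < jointRho d p :=
    (ENNReal.ofReal_lt_iff_lt_toReal hs0 (fun htop => by
      rw [htop, ENNReal.toReal_top] at hs; linarith)).mpr hs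
  obtain ⟨k, hk, hlt⟩ := frequently_atTop.mp (frequently_lt_of_lt_limsup (by isBoundedDefault) h1)
    (N + 1)
  have hk' : (0 : ℝ) < k := by exact_mod_cast (by omega : 0 < k)
  have h2 := ENNReal.rpow_lt_rpow hlt hk'
  rw [← ENNReal.rpow_mul, one_div, inv_mul_cancel₀ hk'.ne', ENNReal.rpow_one,
    ENNReal.rpow_natCast, ← ENNReal.ofReal_pow hs0] at h2
  obtain ⟨L, hL⟩ := lt_iSup_iff.mp h2
  obtain ⟨hL1, hL2⟩ := lt_iSup_iff.mp hL
  obtain ⟨σ, hσ1, hσ2⟩ := exists_word_of_list hL1.2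
  refine ⟨σ, by rw [hσ1, hL1.1]; omega, ?_⟩
  rw [← hσ2] at hL2
  have h3 := ENNReal.toReal_mono (rho_ne_top _) hL2.le
  rwa [ENNReal.toReal_ofReal (by positivity), ← hL1.1, ← hσ1] at h3

/-- Completing a word costs a constant factor and boundedly many letters, negligible for the rate of
a long word. So ρ̃ is already approached by words beginning with a middle digit, those with interior
periodic points. -/
theorem exists_mid_word_gt (hd : 3 ≤ d) (hm : d ≤ m) (hp : ∀ i, 0 < p i) {s : ℝ} (hs0 : 0 < s)
    (hs : s < (jointRho d p).toReal) :
    ∃ (i : Fin (m + 1)) (σ : List (Fin (m + 1))), i ≠ 0 ∧ i ≠ Fin.last m ∧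
      s ^ (i :: σ).length < realRho (wordMatrix d p (i :: σ)) := by
  obtain ⟨t, hst, ht⟩ := exists_between hs
  obtain ⟨c, hc, E, hE⟩ := exists_completion hd hm hp
  -- The word is taken so long that the surplus (t/s)^N outweighs the completion constant c and at
  -- most E extra letters.
  obtain ⟨N, hN⟩ := pow_unbounded_of_one_lt (max 1 s ^ E / c) ((one_lt_div hs0).mpr hst)
  obtain ⟨σ, hσ1, hσ2⟩ := exists_word_gt (hs0.trans hst).le ht N
  obtain ⟨i, α, θ, hi0, him, hlen, hge⟩ := hE σ
  refine ⟨i, α ++ σ ++ θ, hi0, him, ?_⟩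
  have h1 : i :: (α ++ σ ++ θ) = (i :: α) ++ σ ++ θ := by simp
  rw [h1]
  have h2 := diag_le_realRho (wordMatrix_nonneg (d := d) hp ((i :: α) ++ σ ++ θ)) (zeroIdx d m)
  have h3 := realRho_le_entrySum (wordMatrix_nonneg (d := d) hp σ)
  have hlen' : ((i :: α) ++ σ ++ θ).length = ((i :: α).length + θ.length) + σ.length := by
    simp only [List.length_append]; omega
  rw [hlen', pow_add]
  have h4 : s ^ ((i :: α).length + θ.length) ≤ max 1 s ^ E :=
    (pow_le_pow_left₀ hs0.le (le_max_right 1 s) _).trans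
      (pow_le_pow_right₀ (le_max_left 1 s) hlen)
  have h5 : max 1 s ^ E / c < (t / s) ^ σ.length :=
    hN.trans_le (pow_le_pow_right₀ ((one_lt_div hs0).mpr hst).le hσ1)
  rw [div_pow, div_lt_div_iff₀ hc (by positivity)] at h5
  calc s ^ ((i :: α).length + θ.length) * s ^ σ.length ≤ max 1 s ^ E * s ^ σ.length :=
        mul_le_mul_of_nonneg_right h4 (by positivity)
    _ < t ^ σ.length * c := h5
    _ ≤ c * entrySum (wordMatrix d p σ) := by
        rw [mul_comm]
        exact mul_le_mul_of_nonneg_left (hσ2.trans h3) hc.le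
    _ ≤ _ := hge.trans h2

theorem lowerRho_le {i : Fin (m + 1)} (hi0 : i ≠ 0) (him : i ≠ Fin.last m)
    (σ : List (Fin (m + 1))) :
    lowerRho d p ≤ rho (wordMatrix d p (i :: σ)) ^ (1 / ((i :: σ).length : ℝ)) :=
  iInf₂_le (i :: σ) ⟨i, σ, rfl, hi0, him⟩

theorem lowerRho_ne_top (hd : 3 ≤ d) (hm : d ≤ m) : lowerRho d p ≠ ⊤ := by
  refine ne_top_of_le_ne_top ?_ (lowerRho_le (i := ⟨1, by omega⟩) (fun h => ?_) (fun h => ?_) [])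
  · exact ENNReal.rpow_ne_top_of_nonneg (by positivity) (rho_ne_top _)
  · have := congrArg Fin.val h
    simp at this
  · have := congrArg Fin.val h
    simp only [Fin.val_last] at this
    omega

theorem lowerRho_pow_le {i : Fin (m + 1)} (hi0 : i ≠ 0)
    (him : i ≠ Fin.last m) (σ : List (Fin (m + 1))) :
    (lowerRho d p).toReal ^ (i :: σ).length ≤ realRho (wordMatrix d p (i :: σ)) := by
  have hn' : ((i :: σ).length : ℝ) ≠ 0 := by
    rw [List.length_cons]
    positivity
  have h := ENNReal.rpow_le_rpow (lowerRho_le (d := d) (p := p) hi0 him σ)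
    (Nat.cast_nonneg (α := ℝ) (i :: σ).length)
  rw [← ENNReal.rpow_mul, one_div, inv_mul_cancel₀ hn', ENNReal.rpow_one,
    ENNReal.rpow_natCast] at h
  rw [← ENNReal.toReal_pow]
  exact ENNReal.toReal_mono (rho_ne_top _) h

theorem le_lowerRho (hd : 3 ≤ d) (hm : d ≤ m) {s : ℝ} (hs0 : 0 ≤ s)
    (h : ∀ (i : Fin (m + 1)) (σ : List (Fin (m + 1))), i ≠ 0 → i ≠ Fin.last m →
      s ^ (i :: σ).length ≤ realRho (wordMatrix d p (i :: σ))) :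
    s ≤ (lowerRho d p).toReal := by
  rw [← ENNReal.toReal_ofReal hs0]
  refine ENNReal.toReal_mono (lowerRho_ne_top hd hm) (le_iInf₂ fun τ hτ => ?_)
  obtain ⟨i, σ, rfl, hi0, him⟩ := hτ
  have hn' : ((i :: σ).length : ℝ) ≠ 0 := by
    rw [List.length_cons]
    positivity
  have h1 := ENNReal.ofReal_le_ofReal (h i σ hi0 him)
  rw [ENNReal.ofReal_pow hs0, ofReal_realRho, ← ENNReal.rpow_natCast] at h1
  have h2 := ENNReal.rpow_le_rpow h1
    (by positivity : (0 : ℝ) ≤ 1 / ((i :: σ).length : ℝ))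
  rwa [← ENNReal.rpow_mul, mul_one_div, div_self hn', ENNReal.rpow_one] at h2

/-- If a word grows exactly at a rate not above the last weight, then some words beginning with
the same digit grow at slightly larger rates. -/
theorem exists_word_rate_between (hd : 3 ≤ d) (hm : d ≤ m) (hp : ∀ i, 0 < p i)
    (hreg : ∀ i : Fin (m + 1), i ≠ 0 → p (Fin.last m) ≤ p i) {σ : List (Fin (m + 1))}
    {r s : ℝ} (hσ : realRho (wordMatrix d p σ) = r ^ σ.length) (hσ0 : σ ≠ []) (hr0 : 0 < r)
    (hr : r ≤ p (Fin.last m)) (hrs : r < s) (hs1 : s ≤ 1) :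
    ∃ (i : Fin (m + 1)) (τ : List (Fin (m + 1))), i ≠ 0 ∧ i ≠ Fin.last m ∧
      r ^ (i :: τ).length < realRho (wordMatrix d p (i :: τ)) ∧
      realRho (wordMatrix d p (i :: τ)) < s ^ (i :: τ).length := by
  have hn : σ.length ≠ 0 := by simpa using hσ0
  obtain ⟨κ, hκ1, hκ2⟩ := exists_word_overlap_gain hd hm hp hreg
  set h := wordMatrix d p κ (zeroIdx d m) (zeroIdx d m) with hh
  have hrh : r ^ 2 < h := (pow_le_pow_left₀ hr0.le hr 2).trans_lt hκ2
  have hh0 : 0 < h := (pow_pos hr0 2).trans hrh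
  obtain ⟨c, hc, E, hE⟩ := exists_completion hd hm hp
  obtain ⟨K, B, hK, hB, hKB⟩ := exists_entrySum_wordMatrix_le (d := d) hp
  -- b is fixed first: b copies of κ gain enough over r^(2b) to compensate the loss c of the
  -- completion, whatever the number of copies of σ.
  obtain ⟨b, hb⟩ := pow_unbounded_of_one_lt (1 / c) ((one_lt_div (pow_pos hr0 2)).mpr hrh)
  rw [div_pow, div_lt_div_iff₀ hc (by positivity), one_mul] at hb
  obtain ⟨t, hrt, hts⟩ := exists_between hrs
  have ht0 : 0 < t := hr0.trans hrt
  have hs0 : 0 < s := ht0.trans hts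
  obtain ⟨C, hC, hC'⟩ := exists_entrySum_pow_le (wordMatrix_nonneg (d := d) hp σ)
    (s := t ^ σ.length) (by rw [hσ]; exact pow_lt_pow_left₀ hrt hr0.le hn)
  set Q := K * B ^ E * (C * (K * B ^ E)) with hQ
  have hQ0 : 0 < Q := by positivity
  -- With b fixed, A copies of σ of rate below t < s absorb the bounded contributions of κ and of
  -- the completion, keeping the total rate below s.
  obtain ⟨A, hA⟩ := pow_unbounded_of_one_lt (K * B ^ (2 * b) * Q / s ^ (E + 2 * b))
    (one_lt_pow₀ ((one_lt_div ht0).mpr hts) hn)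
  rw [← pow_mul, div_pow, div_lt_div_iff₀ (by positivity) (by positivity)] at hA
  obtain ⟨i, α, θ, hi0, him, hlen, hge⟩ := hE (wordPow σ A)
  refine ⟨i, α ++ wordPow σ A ++ θ ++ wordPow κ b, hi0, him, ?_⟩
  have h1 : i :: (α ++ wordPow σ A ++ θ ++ wordPow κ b) =
      ((i :: α) ++ wordPow σ A ++ θ) ++ wordPow κ b := by simp
  have hl : (((i :: α) ++ wordPow σ A ++ θ) ++ wordPow κ b).length =
      σ.length * A + ((i :: α).length + θ.length + 2 * b) := by
    simp only [List.length_append, length_wordPow, hκ1]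
    ring
  rw [h1, hl, pow_add _ (σ.length * A), pow_add _ (σ.length * A)]
  set e := (i :: α).length + θ.length with he
  have hnn := wordMatrix_nonneg (d := d) hp
  constructor
  · have h2 := mul_le_wordMatrix_append (d := d) hp ((i :: α) ++ wordPow σ A ++ θ) (wordPow κ b)
      (zeroIdx d m) (zeroIdx d m) (zeroIdx d m)
    have h3 := diag_pow_le (hnn κ) (zeroIdx d m) b
    rw [← wordMatrix_wordPow, ← hh] at h3
    have h4 := realRho_pow_le_entrySum (hnn σ) A
    rw [← wordMatrix_wordPow, hσ, ← pow_mul] at h4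
    have h5 := diag_le_realRho (hnn (((i :: α) ++ wordPow σ A ++ θ) ++ wordPow κ b)) (zeroIdx d m)
    have hr1 : r ≤ 1 := (hrs.le).trans hs1
    calc r ^ (σ.length * A) * r ^ (e + 2 * b)
        ≤ r ^ (σ.length * A) * r ^ (2 * b) :=
          mul_le_mul_of_nonneg_left (pow_le_pow_of_le_one hr0.le hr1 (by omega)) (by positivity)
      _ < r ^ (σ.length * A) * (h ^ b * c) :=
          mul_lt_mul_of_pos_left (by rwa [pow_mul]) (by positivity)
      _ = h ^ b * (c * r ^ (σ.length * A)) := by ring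
      _ ≤ wordMatrix d p (wordPow κ b) (zeroIdx d m) (zeroIdx d m) *
          wordMatrix d p ((i :: α) ++ wordPow σ A ++ θ) (zeroIdx d m) (zeroIdx d m) :=
          mul_le_mul h3 ((mul_le_mul_of_nonneg_left h4 hc.le).trans hge) (by positivity)
            (hnn _ _ _)
      _ ≤ _ := h2.trans h5
  · have hshort : ∀ w : List (Fin (m + 1)), w.length ≤ E →
        entrySum (wordMatrix d p w) ≤ K * B ^ E := fun w hw =>
      (hKB w).trans (mul_le_mul_of_nonneg_left (pow_le_pow_right₀ hB hw) (by linarith))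
    have h2 := hC' A
    rw [← wordMatrix_wordPow, ← pow_mul] at h2
    have h3 := hKB (wordPow κ b)
    rw [length_wordPow, hκ1, mul_comm b 2] at h3
    have hS := fun w => entrySum_nonneg (hnn w)
    have h4 : entrySum (wordMatrix d p ((i :: α) ++ wordPow σ A ++ θ)) ≤
        K * B ^ E * (C * t ^ (σ.length * A) * (K * B ^ E)) := by
      rw [wordMatrix_append, wordMatrix_append]
      refine (entrySum_mul_le (hnn θ) (by rw [← wordMatrix_append]; exact hnn _)).trans
        (mul_le_mul (hshort θ (by omega)) ((entrySum_mul_le (hnn _) (hnn _)).trans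
          (mul_le_mul h2 (hshort _ (by omega)) (hS _) (by positivity)))
          (by rw [← wordMatrix_append]; exact hS _) (by positivity))
    have h5 := realRho_le_entrySum (hnn (((i :: α) ++ wordPow σ A ++ θ) ++ wordPow κ b))
    have h6 : s ^ (E + 2 * b) ≤ s ^ (e + 2 * b) :=
      pow_le_pow_of_le_one hs0.le hs1 (by omega)
    calc _ ≤ _ := h5
      _ ≤ K * B ^ (2 * b) * (K * B ^ E * (C * t ^ (σ.length * A) * (K * B ^ E))) := by
          rw [wordMatrix_append]
          exact (entrySum_mul_le (hnn _) (hnn _)).trans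
            (mul_le_mul h3 h4 (hS _) (by positivity))
      _ = K * B ^ (2 * b) * Q * t ^ (σ.length * A) := by rw [hQ]; ring
      _ < s ^ (σ.length * A) * s ^ (E + 2 * b) := hA
      _ ≤ _ := mul_le_mul_of_nonneg_left h6 (by positivity)

end Growth

/-! ### Bounds on local dimensions and periodic points -/

section Dimensions

variable {d m : ℕ} {p : Fin (m + 1) → ℝ} {μ : Measure ℝ}

theorem one_lt_base (hd : 3 ≤ d) : (1 : ℝ) < d := by
  have h3 : (3 : ℝ) ≤ d := by exact_mod_cast hd
  linarith

theorem delta_neg (hd : 3 ≤ d) : delta d < 0 :=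
  div_neg_of_neg_of_pos (by norm_num) (Real.log_pos (one_lt_base hd))

theorem zero_mem_Icc (hd : 3 ≤ d) (hm : d ≤ m) : (0 : ℝ) ∈ Set.Icc 0 (rightEnd d m) :=
  ⟨le_rfl, by linarith [one_lt_rightEnd hd hm]⟩

theorem IsSelfSimilar.upperLocalDim_le_first (hμ : IsSelfSimilar d p μ) (hd : 3 ≤ d) (hm : d ≤ m)
    (hp : ∀ i, 0 < p i) (hmin : ∀ i, p 0 ≤ p i) {x : ℝ} (hx : x ∈ Set.Icc 0 (rightEnd d m)) :
    upperLocalDim μ x ≤ ((delta d * Real.log (p 0) : ℝ) : EReal) := by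
  have := hμ.isProb
  exact upperLocalDim_le (C := rightEnd d m + 1) (C' := 1) (one_lt_base hd) (hp 0)
    (by linarith [one_lt_rightEnd hd hm]) one_pos
    fun j => by rw [one_mul]; exact hμ.pow_le_real_ball hd hm hp hmin hx j

theorem IsSelfSimilar.localDim_of_ball_eq (hμ : IsSelfSimilar d p μ) (hd : 3 ≤ d) (hm : d ≤ m)
    (hp : ∀ i, 0 < p i) (hmin : ∀ i, p 0 ≤ p i) {x q : ℝ} (hx : x ∈ Set.Icc 0 (rightEnd d m))
    (hq : 0 < q)
    (h : ∀ n : ℕ, μ.real (Metric.ball x (1 / (d : ℝ) ^ n)) = q ^ n * μ.real (Metric.ball x 1)) :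
    lowerLocalDim μ x = ((delta d * Real.log q : ℝ) : EReal) ∧
      upperLocalDim μ x = ((delta d * Real.log q : ℝ) : EReal) := by
  have := hμ.isProb
  have hpos := fun r (hr : 0 < r) => hμ.real_ball_pos hd hm hp hmin hx hr
  have h1 := upperLocalDim_le (x := x) (one_lt_base hd) hq one_pos (hpos 1 one_pos)
    fun j => ((h j).trans (mul_comm _ _)).ge
  have h2 := le_lowerLocalDim (x := x) (one_lt_base hd) hq one_pos (hpos 1 one_pos) hpos
    fun j => ((h j).trans (mul_comm _ _)).le
  have h3 := lowerLocalDim_le_upperLocalDim μ x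
  exact ⟨le_antisymm (h3.trans h1) h2, le_antisymm h1 (h2.trans h3)⟩

/-- No lower local dimension is below the one given by the joint spectral radius. -/
theorem IsSelfSimilar.jointRho_le_lowerLocalDim (hμ : IsSelfSimilar d p μ) (hd : 3 ≤ d)
    (hm : d ≤ m) (hp : ∀ i, 0 < p i) (hmin : ∀ i, p 0 ≤ p i) {x : ℝ}
    (hx : x ∈ Set.Icc 0 (rightEnd d m)) :
    ((delta d * Real.log (jointRho d p).toReal : ℝ) : EReal) ≤ lowerLocalDim μ x := by
  have := hμ.isProb
  have hpos := fun r (hr : 0 < r) => hμ.real_ball_pos hd hm hp hmin hx hr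
  set G := (jointRho d p).toReal with hG
  have hGp : ∀ i, p i ≤ G := le_jointRho hp
  have hG0 : 0 < G := (hp 0).trans_le (hGp 0)
  have hmono : ∀ i, ((delta d * Real.log G : ℝ) : EReal) ≤ ((delta d * Real.log (p i) : ℝ) : EReal) :=
    fun i => EReal.coe_le_coe_iff.mpr
      (mul_le_mul_of_nonpos_left (Real.log_le_log (hp i) (hGp i)) (delta_neg hd).le)
  rcases eq_or_lt_of_le hx.1 with h0 | h0
  · subst h0
    rw [(hμ.localDim_of_ball_eq hd hm hp hmin hx (hp 0) (hμ.real_ball_zero hd hp)).1]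
    exact hmono 0
  rcases eq_or_lt_of_le hx.2 with h1 | h1
  · subst h1
    rw [(hμ.localDim_of_ball_eq hd hm hp hmin hx (hp _) (hμ.real_ball_rightEnd hd hp)).1]
    exact hmono _
  -- An interior x has an expansion all of whose remainders stay η away from the end points, so the
  -- ball of radius η about each remainder lies in (0, R), as `IsSelfSimilar.real_ball_le` requires.
  obtain ⟨η, hη0, hη⟩ : ∃ η : ℝ, 0 < η ∧ η ≤ min (1 / (2 * (d : ℝ))) (min x (rightEnd d m - x)) :=
    ⟨_, lt_min (by have := one_lt_base hd; positivity) (lt_min h0 (by linarith)), le_rfl⟩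
  rw [le_min_iff, le_min_iff] at hη
  obtain ⟨c, hc, E, hE⟩ := exists_completion hd hm hp
  refine le_lowerLocalDim (C := η) (C' := max 1 G ^ E / c) (one_lt_base hd) hG0 hη0
    (by positivity) hpos fun n => ?_
  obtain ⟨σ, rfl, y, hy, rfl⟩ := exists_word_mem_Icc hd hm hη0.le hη.1 n (x := x)
    ⟨hη.2.1, by linarith⟩
  have hball : Metric.ball y η ⊆ Set.Ioo 0 (rightEnd d m) := fun z hz => by
    rw [Metric.mem_ball, Real.dist_eq, abs_lt] at hz
    constructor <;> linarith [hy.1, hy.2]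
  obtain ⟨i, α, θ, -, -, hlen, hge⟩ := hE σ
  have hnn := wordMatrix_nonneg (d := d) hp
  have h2 : ∑ k, wordMatrix d p σ k (zeroIdx d m) ≤ entrySum (wordMatrix d p σ) :=
    Finset.sum_le_sum fun k _ => Finset.single_le_sum (f := fun l => wordMatrix d p σ k l)
      (fun l _ => hnn σ k l) (Finset.mem_univ _)
  have h3 := (diag_le_realRho (hnn ((i :: α) ++ σ ++ θ)) (zeroIdx d m)).trans
    (realRho_le_jointRho_pow hp (by simp))
  have hlen' : ((i :: α) ++ σ ++ θ).length = ((i :: α).length + θ.length) + σ.length := by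
    simp only [List.length_append]; omega
  rw [hlen', pow_add, ← hG] at h3
  have h4 : G ^ ((i :: α).length + θ.length) ≤ max 1 G ^ E :=
    (pow_le_pow_left₀ hG0.le (le_max_right 1 G) _).trans
      (pow_le_pow_right₀ (le_max_left 1 G) hlen)
  refine (hμ.real_ball_le hd hm hp σ hball).trans (h2.trans ?_)
  rw [div_mul_eq_mul_div, le_div_iff₀ hc, mul_comm]
  exact hge.trans (h3.trans (mul_le_mul_of_nonneg_right h4 (by positivity)))

/-- An interior point has an expansion whose beginning reaches all offsets and which continues
with a middle digit. -/
theorem exists_expansion (hd : 3 ≤ d) (hm : d ≤ m) (hp : ∀ i, 0 < p i) (hmin : ∀ i, p 0 ≤ p i)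
    {x : ℝ} (hx : x ∈ Set.Ioo 0 (rightEnd d m)) :
    ∃ τ : List (Fin (m + 1)), (∀ l, 0 < wordMatrix d p τ l (zeroIdx d m)) ∧
      ∃ i : Fin (m + 1), i ≠ 0 ∧ i ≠ Fin.last m ∧
        ∃ y ∈ Set.Icc 0 (rightEnd d m), x = contract d (τ ++ [i]) y := by
  have key : ∀ N : ℕ, ∃ u : List (Fin (m + 1)), ∃ i : Fin (m + 1), ∃ θ : List (Fin (m + 1)),
      i ≠ 0 ∧ i ≠ Fin.last m ∧ N ≤ θ.length ∧
      ∃ y ∈ Set.Ioo 0 (rightEnd d m), x = contract d (u ++ (i :: θ)) y := by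
    intro N
    induction N with
    | zero =>
      obtain ⟨u, i, hi0, him, y, hy, hxy⟩ := exists_word_mid hd hm hx
      exact ⟨u, i, [], hi0, him, le_rfl, y, hy, hxy⟩
    | succ N ih =>
      obtain ⟨u, i, θ, hi0, him, hN, y, hy, hxy⟩ := ih
      obtain ⟨u', i', -, -, y', hy', hyy⟩ := exists_word_mid hd hm hy
      refine ⟨u, i, θ ++ (u' ++ [i']), hi0, him, by simp; omega, y', hy', ?_⟩
      rw [hxy, hyy, ← contract_append]
      simp
  -- A middle digit followed by a letters fills the band. One more middle digit is then located, so
  -- that what follows the prefix is a word of the kind `lowerRho` measures.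
  obtain ⟨u, i, θ, hi0, him, hN, y, hy, hxy⟩ := key (bandwidth d m)
  obtain ⟨u', i', hi0', him', y', hy', hyy⟩ := exists_word_mid hd hm hy
  refine ⟨u ++ (i :: (θ ++ u')), fun l => ?_, i', hi0', him', y', ⟨hy'.1.le, hy'.2.le⟩, ?_⟩
  · exact (mul_pos (column_pos hd hm hp hi0 him (by simp; omega) l)
      (wordMatrix_zero_zero_pos hp hmin u)).trans_le
      (mul_le_wordMatrix_append hp u (i :: (θ ++ u')) l (zeroIdx d m) (zeroIdx d m))
  · rw [hxy, hyy, ← contract_append]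
    simp

/-- A prefix reaching all offsets lets column 0 see every column of M(σ). The column sum, which
measures a ball, then dominates the entry sum, and hence the spectral radius. -/
theorem exists_mul_entrySum_le_column (hp : ∀ i, 0 < p i) {τ : List (Fin (m + 1))}
    (hτ : ∀ l, 0 < wordMatrix d p τ l (zeroIdx d m)) :
    ∃ c : ℝ, 0 < c ∧ ∀ σ : List (Fin (m + 1)),
      c * entrySum (wordMatrix d p σ) ≤ ∑ k, wordMatrix d p (τ ++ σ) k (zeroIdx d m) := by
  obtain ⟨l0, -, hl0⟩ := Finset.exists_min_image Finset.univ
    (fun l => wordMatrix d p τ l (zeroIdx d m)) Finset.univ_nonempty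
  refine ⟨_, hτ l0, fun σ => ?_⟩
  unfold entrySum
  rw [Finset.mul_sum]
  refine Finset.sum_le_sum fun k _ => ?_
  rw [wordMatrix_append, Matrix.mul_apply, Finset.mul_sum]
  refine Finset.sum_le_sum fun l _ => ?_
  rw [mul_comm]
  exact mul_le_mul_of_nonneg_left (hl0 l (Finset.mem_univ l)) (wordMatrix_nonneg hp σ k l)

/-- At interior points the upper local dimension is at most the one given by the infimum of the
spectral radii of the words beginning with a middle digit. -/
theorem IsSelfSimilar.upperLocalDim_le_lowerRho (hμ : IsSelfSimilar d p μ) (hd : 3 ≤ d)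
    (hm : d ≤ m) (hp : ∀ i, 0 < p i) (hmin : ∀ i, p 0 ≤ p i)
    (hρ : 0 < (lowerRho d p).toReal) {x : ℝ} (hx : x ∈ Set.Ioo 0 (rightEnd d m)) :
    upperLocalDim μ x ≤ ((delta d * Real.log (lowerRho d p).toReal : ℝ) : EReal) := by
  have := hμ.isProb
  have hd1 := one_lt_base hd
  obtain ⟨τ, hτ, i, hi0, him, y, hy, rfl⟩ := exists_expansion hd hm hp hmin hx
  obtain ⟨c, hc, hcτ⟩ := exists_mul_entrySum_le_column hp hτ
  obtain ⟨c0, hc0, hball⟩ := hμ.exists_le_real_ball hd hm hp hmin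
  set R := (lowerRho d p).toReal with hR
  have hend := one_lt_rightEnd hd hm
  refine upperLocalDim_le (C := (rightEnd d m + 1) / (d : ℝ) ^ (τ.length + 1))
    (C' := c0 * (c * R)) hd1 hρ (by positivity) (by positivity) fun n => ?_
  obtain ⟨σ, rfl, z, hz, rfl⟩ := exists_word_mem_Icc hd hm le_rfl (by positivity) n
    (x := y) (by simpa using hy)
  have h1 := hball (τ ++ (i :: σ)) z (by simpa using hz)
  have h2 := hcτ (i :: σ)
  have h3 := (lowerRho_pow_le (d := d) (p := p) hi0 him σ).trans
    (realRho_le_entrySum (wordMatrix_nonneg hp _))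
  rw [← contract_append]
  have h4 : τ ++ [i] ++ σ = τ ++ (i :: σ) := by simp
  have h5 : (rightEnd d m + 1) / (d : ℝ) ^ (τ.length + 1) / (d : ℝ) ^ σ.length =
      (rightEnd d m + 1) / (d : ℝ) ^ (τ ++ (i :: σ)).length := by
    rw [div_div, ← pow_add, List.length_append, List.length_cons]
    congr 2
    omega
  rw [h4, h5]
  refine le_trans ?_ h1
  rw [mul_assoc]
  refine mul_le_mul_of_nonneg_left (le_trans ?_ h2) hc0.le
  rw [mul_assoc]
  refine mul_le_mul_of_nonneg_left (le_trans (le_of_eq ?_) h3) hc.le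
  rw [List.length_cons, pow_succ, mul_comm]

theorem contract_wordPow {σ : List (Fin (m + 1))} {x : ℝ} (hx : contract d σ x = x) (j : ℕ) :
    contract d (wordPow σ j) x = x := by
  induction j with
  | zero => simp [wordPow, contract]
  | succ j ih => rw [wordPow_succ, contract_append, ih, hx]

/-- The periodic point of a word beginning with a middle digit has a local dimension, given by
the spectral radius of the word. -/
theorem IsSelfSimilar.rate_mem_localDims (hμ : IsSelfSimilar d p μ) (hd : 3 ≤ d)
    (hm : d ≤ m) (hp : ∀ i, 0 < p i) (hmin : ∀ i, p 0 ≤ p i) {i : Fin (m + 1)} (hi0 : i ≠ 0)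
    (him : i ≠ Fin.last m) (σ : List (Fin (m + 1))) :
    ((delta d * (Real.log (realRho (wordMatrix d p (i :: σ))) / (i :: σ).length) : ℝ) : EReal) ∈
      localDims μ := by
  have := hμ.isProb
  have hd1 := one_lt_base hd
  have hend := one_lt_rightEnd hd hm
  obtain ⟨x, hx, hfix⟩ := exists_fixed_point hd hm hi0 him σ
  have hxI : x ∈ Set.Icc 0 (rightEnd d m) := ⟨hx.1.le, hx.2.le⟩
  have hpos := fun r (hr : 0 < r) => hμ.real_ball_pos hd hm hp hmin hxI hr
  have hnn := wordMatrix_nonneg (d := d) hp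
  set w := i :: σ with hw
  have hwn : w.length ≠ 0 := by simp [hw]
  set ρ := realRho (wordMatrix d p w)
  have hρ : 0 < ρ := realRho_wordMatrix_pos hp hmin w
  have hD : 1 < (d : ℝ) ^ w.length := one_lt_pow₀ hd1 hwn
  have hlogd : 0 < Real.log d := Real.log_pos hd1
  have hrate : ∀ s : ℝ, -1 / Real.log ((d : ℝ) ^ w.length) * Real.log s =
      delta d * (Real.log s / w.length) := fun s => by
    rw [Real.log_pow, delta]
    have : (w.length : ℝ) ≠ 0 := by exact_mod_cast hwn
    field_simp
  have hup : upperLocalDim μ x ≤ ((delta d * (Real.log ρ / w.length) : ℝ) : EReal) := by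
    -- One copy of w supplies the middle digit and the other a copies at least a further letters, so
    -- τ reaches all offsets; it only changes the constants.
    set τ := wordPow w (bandwidth d m + 1) with hτdef
    have hτ : ∀ l, 0 < wordMatrix d p τ l (zeroIdx d m) := fun l => by
      rw [hτdef, wordPow_succ, hw, List.cons_append]
      refine column_pos hd hm hp hi0 him ?_ l
      rw [List.length_append, length_wordPow, List.length_cons]
      nlinarith [Nat.zero_le σ.length]
    obtain ⟨c, hc, hcτ⟩ := exists_mul_entrySum_le_column hp hτ
    obtain ⟨c0, hc0, hball⟩ := hμ.exists_le_real_ball hd hm hp hmin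
    rw [← hrate]
    refine upperLocalDim_le (C := (rightEnd d m + 1) / (d : ℝ) ^ τ.length)
      (C' := c0 * c) hD hρ (by positivity) (by positivity) fun j => ?_
    have h1 := hball (τ ++ wordPow w j) x hxI
    have h2 := hcτ (wordPow w j)
    have h3 := realRho_pow_le_entrySum (hnn w) j
    rw [← wordMatrix_wordPow] at h3
    rw [contract_append, contract_wordPow hfix, contract_wordPow hfix, List.length_append,
      length_wordPow w j, pow_add, ← div_div, mul_comm j, pow_mul] at h1
    refine le_trans ?_ h1
    rw [mul_assoc]
    exact mul_le_mul_of_nonneg_left ((mul_le_mul_of_nonneg_left h3 hc.le).trans h2) hc0.le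
  have hlow : ((delta d * (Real.log ρ / w.length) : ℝ) : EReal) ≤ lowerLocalDim μ x := by
    -- The entry sums of the powers of M(w) need not be O(ρ^j), so the mass is bounded at every rate
    -- s > ρ, and s then tends to ρ.
    have hlim : Tendsto (fun s : ℝ => ((delta d * (Real.log s / w.length) : ℝ) : EReal))
        (𝓝[>] ρ) (𝓝 ((delta d * (Real.log ρ / w.length) : ℝ) : EReal)) := by
      rw [EReal.tendsto_coe]
      exact (((Real.continuousAt_log hρ.ne').tendsto.div_const _).const_mul _).mono_left
        nhdsWithin_le_nhds
    refine le_of_tendsto hlim ?_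
    filter_upwards [self_mem_nhdsWithin] with s hs
    obtain ⟨C, hC, hC'⟩ := exists_entrySum_pow_le (hnn w) hs
    rw [← hrate]
    have hη : 0 < min x (rightEnd d m - x) := lt_min hx.1 (by linarith [hx.2])
    refine le_lowerLocalDim hD (hρ.trans hs) hη hC hpos fun j => ?_
    have hsub : Metric.ball x (min x (rightEnd d m - x)) ⊆ Set.Ioo 0 (rightEnd d m) :=
      fun z hz => by
        rw [Metric.mem_ball, Real.dist_eq, lt_min_iff, abs_lt, abs_lt] at hz
        constructor <;> linarith [hz.1.1, hz.2.2]
    have h1 := hμ.real_ball_le hd hm hp (wordPow w j) hsub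
    rw [contract_wordPow hfix, length_wordPow, mul_comm j, pow_mul] at h1
    refine h1.trans (le_trans ?_ (hC' j))
    rw [← wordMatrix_wordPow]
    exact Finset.sum_le_sum fun k _ => Finset.single_le_sum
      (f := fun l => wordMatrix d p (wordPow w j) k l) (fun l _ => hnn _ k l) (Finset.mem_univ _)
  have h3 := lowerLocalDim_le_upperLocalDim μ x
  refine ⟨x, ?_, le_antisymm (h3.trans hup) hlow, le_antisymm hup (hlow.trans h3)⟩
  rw [hμ.support_eq hd hm hp hmin]
  exact hxI

end Dimensions

/-! ### The infimum, the inclusion and its optimality, the gap -/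

section Conclusion

variable {d m : ℕ} {p : Fin (m + 1) → ℝ} {μ : Measure ℝ}

theorem coe_delta_mul_log {d : ℕ} {t : ℝ≥0∞} (ht : 0 < t.toReal) :
    ((delta d * Real.log t.toReal : ℝ) : EReal) = (delta d : EReal) * ENNReal.log t := by
  rw [ENNReal.log_pos_real' ht, EReal.coe_mul]

/-- If all middle weights exceed `p 0`, then the words grow at a rate strictly above `p 0`. -/
theorem lt_lowerRho (hd : 3 ≤ d) (hm : d ≤ m) (hp : ∀ i, 0 < p i) (hmin : ∀ i, p 0 ≤ p i)
    (hp1 : ∀ i, p i ≤ 1) (h : ∀ i : Fin (m + 1), i ≠ 0 → i ≠ Fin.last m → p 0 < p i) :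
    p 0 < (lowerRho d p).toReal := by
  obtain ⟨q, hq, hq1, hqmid⟩ : ∃ q, p 0 < q ∧ q ≤ 1 ∧
      ∀ i : Fin (m + 1), i ≠ 0 → i ≠ Fin.last m → q ≤ p i := by
    have hne : (Finset.univ.filter fun i : Fin (m + 1) => i ≠ 0 ∧ i ≠ Fin.last m).Nonempty := by
      refine ⟨⟨1, by omega⟩, ?_⟩
      rw [Finset.mem_filter]
      refine ⟨Finset.mem_univ _, fun h => ?_, fun h => ?_⟩
      · have := congrArg Fin.val h
        simp at this
      · have := congrArg Fin.val h
        simp only [Fin.val_last] at this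
        omega
    obtain ⟨i, hi, hi'⟩ := Finset.exists_min_image _ p hne
    rw [Finset.mem_filter] at hi
    exact ⟨p i, h i hi.2.1 hi.2.2, hp1 i, fun j h0 hl =>
      hi' j (Finset.mem_filter.mpr ⟨Finset.mem_univ _, h0, hl⟩)⟩
  have hq0 : 0 < q := (hp 0).trans hq
  -- Two letters pay at least p_0 q rather than p_0², so the rate is bounded below by the geometric
  -- mean of p_0 and q, which exceeds p_0.
  have hs2 : Real.sqrt (p 0 * q) ^ 2 = p 0 * q := Real.sq_sqrt (mul_pos (hp 0) hq0).le
  have hs1 : Real.sqrt (p 0 * q) ≤ 1 := by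
    rw [Real.sqrt_le_one]
    exact mul_le_one₀ (hp1 0) hq0.le hq1
  refine lt_of_lt_of_le (Real.lt_sqrt_of_sq_lt ?_) (le_lowerRho hd hm (Real.sqrt_nonneg (p 0 * q))
    fun i σ _ _ => pow_le_realRho_wordMatrix hd hm hp hmin (hp1 0) hq0 hqmid
      (Real.sqrt_nonneg _) hs1 hs2 _)
  rw [sq]
  exact mul_lt_mul_of_pos_left hq (hp 0)

theorem le_lowerRho_first (hd : 3 ≤ d) (hm : d ≤ m) (hp : ∀ i, 0 < p i)
    (hmin : ∀ i, p 0 ≤ p i) : p 0 ≤ (lowerRho d p).toReal :=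
  le_lowerRho hd hm (hp 0).le fun i σ _ _ =>
    (pow_le_wordMatrix_zero_zero hp hmin (i :: σ)).trans
      (diag_le_realRho (wordMatrix_nonneg hp _) _)

/-- For each s < ρ̃ some word beginning with a middle digit has rate above s, and its periodic point
has dimension at most δ log s. Letting s tend to ρ̃ gives the bound; the infimum need not be
attained. -/
theorem IsSelfSimilar.sInf_localDims_le (hμ : IsSelfSimilar d p μ) (hd : 3 ≤ d)
    (hm : d ≤ m) (hp : ∀ i, 0 < p i) (hmin : ∀ i, p 0 ≤ p i) :
    sInf (localDims μ) ≤ ((delta d * Real.log (jointRho d p).toReal : ℝ) : EReal) := by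
  have hG : 0 < (jointRho d p).toReal := (hp 0).trans_le (le_jointRho hp 0)
  have hlim : Tendsto (fun s : ℝ => ((delta d * Real.log s : ℝ) : EReal))
      (𝓝[<] (jointRho d p).toReal)
      (𝓝 ((delta d * Real.log (jointRho d p).toReal : ℝ) : EReal)) := by
    rw [EReal.tendsto_coe]
    exact ((Real.continuousAt_log hG.ne').tendsto.const_mul _).mono_left nhdsWithin_le_nhds
  refine ge_of_tendsto hlim ?_
  filter_upwards [Ioo_mem_nhdsLT hG] with s hs
  obtain ⟨i, σ, hi0, him, hlt⟩ := exists_mid_word_gt hd hm hp hs.1 hs.2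
  refine (sInf_le (hμ.rate_mem_localDims hd hm hp hmin hi0 him σ)).trans
    (EReal.coe_le_coe_iff.mpr (mul_le_mul_of_nonpos_left ?_ (delta_neg hd).le))
  have hn : (0 : ℝ) < (i :: σ).length := by rw [List.length_cons]; positivity
  rw [le_div_iff₀ hn, mul_comm, ← Real.log_pow]
  exact Real.log_le_log (pow_pos hs.1 _) hlt.le

theorem IsSelfSimilar.localDims_subset (hμ : IsSelfSimilar d p μ) (hd : 3 ≤ d)
    (hm : d ≤ m) (hp : ∀ i, 0 < p i) (hmin : ∀ i, p 0 ≤ p i) :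
    localDims μ ⊆ Set.Icc ((delta d * Real.log (jointRho d p).toReal : ℝ) : EReal)
        ((delta d * Real.log (lowerRho d p).toReal : ℝ) : EReal)
      ∪ {((delta d * Real.log (p (Fin.last m)) : ℝ) : EReal)}
      ∪ {((delta d * Real.log (p 0) : ℝ) : EReal)} := by
  rintro _ ⟨x, hx, rfl, hup⟩
  rw [hμ.support_eq hd hm hp hmin] at hx
  rcases eq_or_lt_of_le hx.1 with h0 | h0
  · subst h0
    exact Or.inr (hμ.localDim_of_ball_eq hd hm hp hmin hx (hp 0) (hμ.real_ball_zero hd hp)).1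
  rcases eq_or_lt_of_le hx.2 with h1 | h1
  · subst h1
    exact Or.inl (Or.inr
      (hμ.localDim_of_ball_eq hd hm hp hmin hx (hp _) (hμ.real_ball_rightEnd hd hp)).1)
  refine Or.inl (Or.inl ⟨hμ.jointRho_le_lowerLocalDim hd hm hp hmin hx, ?_⟩)
  rw [← hup]
  exact hμ.upperLocalDim_le_lowerRho hd hm hp hmin
    ((hp 0).trans_le (le_lowerRho_first hd hm hp hmin)) ⟨h0, h1⟩

/-- A bound for the local dimensions other than the two exceptional ones bounds the rates of all
words beginning with a middle digit. -/
theorem IsSelfSimilar.rate_le_of_localDims_subset (hμ : IsSelfSimilar d p μ) (hd : 3 ≤ d)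
    (hm : d ≤ m) (hp : ∀ i, 0 < p i) (hmin : ∀ i, p 0 ≤ p i) (hlast : p (Fin.last m) ≤ 1)
    (hlast' : p (Fin.last m) ≠ 1) (hreg : ∀ i : Fin (m + 1), i ≠ 0 → p (Fin.last m) ≤ p i)
    {a : EReal} {β : ℝ}
    (hβ : localDims μ ⊆ Set.Icc a (β : EReal)
      ∪ {((delta d * Real.log (p (Fin.last m)) : ℝ) : EReal)}
      ∪ {((delta d * Real.log (p 0) : ℝ) : EReal)})
    {i : Fin (m + 1)} (hi0 : i ≠ 0) (him : i ≠ Fin.last m) (σ : List (Fin (m + 1))) :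
    delta d * (Real.log (realRho (wordMatrix d p (i :: σ))) / (i :: σ).length) ≤ β := by
  have hδ := delta_neg hd
  have hrho : ∀ w, 0 < realRho (wordMatrix d p w) := realRho_wordMatrix_pos hp hmin
  have hcases : ∀ (i : Fin (m + 1)) (σ : List (Fin (m + 1))), i ≠ 0 → i ≠ Fin.last m →
      delta d * (Real.log (realRho (wordMatrix d p (i :: σ))) / (i :: σ).length) ≤ β ∨
      Real.log (realRho (wordMatrix d p (i :: σ))) / (i :: σ).length =
        Real.log (p (Fin.last m)) ∨
      Real.log (realRho (wordMatrix d p (i :: σ))) / (i :: σ).length = Real.log (p 0) := by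
    intro i σ hi0 him
    rcases hβ (hμ.rate_mem_localDims hd hm hp hmin hi0 him σ) with (h | h) | h
    · exact Or.inl (EReal.coe_le_coe_iff.mp h.2)
    · exact Or.inr (Or.inl (mul_left_cancel₀ hδ.ne (EReal.coe_eq_coe_iff.mp h)))
    · exact Or.inr (Or.inr (mul_left_cancel₀ hδ.ne (EReal.coe_eq_coe_iff.mp h)))
  -- A word violating the bound must have an exceptional rate r, equal to p_m or p_0. Perturbing it
  -- gives a rate that violates the bound without being exceptional.
  by_contra hlt
  push Not at hlt
  obtain ⟨r, hr0, hr, hr', hrσ⟩ : ∃ r, 0 < r ∧ r ≤ p (Fin.last m) ∧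
      (r = p (Fin.last m) ∨ r = p 0) ∧
      Real.log (realRho (wordMatrix d p (i :: σ))) / (i :: σ).length = Real.log r := by
    rcases hcases i σ hi0 him with h | h | h
    · linarith
    · exact ⟨_, hp _, le_rfl, Or.inl rfl, h⟩
    · exact ⟨_, hp _, hmin _, Or.inr rfl, h⟩
  have hn : ∀ (i : Fin (m + 1)) (σ : List (Fin (m + 1))), (0 : ℝ) < (i :: σ).length :=
    fun i σ => by rw [List.length_cons]; positivity
  have hσ : realRho (wordMatrix d p (i :: σ)) = r ^ (i :: σ).length := by
    rw [div_eq_iff (hn i σ).ne', mul_comm, ← Real.log_pow] at hrσ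
    exact Real.log_injOn_pos (hrho _) (pow_pos hr0 _) hrσ
  rw [hrσ] at hlt
  have hr1 : r < 1 := lt_of_le_of_lt hr (lt_of_le_of_ne hlast hlast')
  have hexp : r < Real.exp (β / delta d) := by
    rw [← Real.log_lt_iff_lt_exp hr0, lt_div_iff_of_neg hδ]
    linarith
  -- Rates in (r, s) still correspond to dimensions above β because s ≤ exp(β/δ). When r = p_0 <
  -- p_m, the cap s ≤ p_m also keeps the new rate from landing on the other exceptional value.
  obtain ⟨s, hrs, hs1, hsβ, hsp⟩ : ∃ s, r < s ∧ s ≤ 1 ∧ s ≤ Real.exp (β / delta d) ∧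
      (r < p (Fin.last m) → s ≤ p (Fin.last m)) := by
    by_cases hrl : r < p (Fin.last m)
    · exact ⟨min (Real.exp (β / delta d)) (p (Fin.last m)), lt_min hexp hrl,
        (min_le_right _ _).trans hlast, min_le_left _ _, fun _ => min_le_right _ _⟩
    · exact ⟨min (Real.exp (β / delta d)) 1, lt_min hexp hr1, min_le_right _ _,
        min_le_left _ _, fun h => absurd h hrl⟩
  obtain ⟨j, τ, hj0, hjm, h1, h2⟩ := exists_word_rate_between hd hm hp hreg hσ
    (List.cons_ne_nil _ _) hr0 hr hrs hs1
  have hs0 : 0 < s := hr0.trans hrs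
  have h3 : Real.log r < Real.log (realRho (wordMatrix d p (j :: τ))) / (j :: τ).length := by
    rw [lt_div_iff₀ (hn j τ), mul_comm, ← Real.log_pow]
    exact Real.log_lt_log (pow_pos hr0 _) h1
  have h4 : Real.log (realRho (wordMatrix d p (j :: τ))) / (j :: τ).length < Real.log s := by
    rw [div_lt_iff₀ (hn j τ), mul_comm, ← Real.log_pow]
    exact Real.log_lt_log (hrho _) h2
  rcases hcases j τ hj0 hjm with h | h | h
  · have h5 : Real.log s ≤ β / delta d := (Real.log_le_iff_le_exp hs0).mpr hsβ
    rw [le_div_iff_of_neg hδ] at h5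
    nlinarith
  · rw [h] at h3 h4
    have h5 : r < p (Fin.last m) := (Real.log_lt_log_iff hr0 (hp _)).mp h3
    have h6 : p (Fin.last m) < s := (Real.log_lt_log_iff (hp _) hs0).mp h4
    linarith [hsp h5]
  · rw [h] at h3
    have h5 : r < p 0 := (Real.log_lt_log_iff hr0 (hp _)).mp h3
    rcases hr' with h6 | h6
    · linarith [hmin (Fin.last m)]
    · linarith

theorem log_lowerRho_le (hd : 3 ≤ d) (hm : d ≤ m) (hρ : 0 < (lowerRho d p).toReal) {β : ℝ}
    (hpos : ∀ σ : List (Fin (m + 1)), 0 < realRho (wordMatrix d p σ))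
    (h : ∀ (i : Fin (m + 1)) (σ : List (Fin (m + 1))), i ≠ 0 → i ≠ Fin.last m →
      delta d * (Real.log (realRho (wordMatrix d p (i :: σ))) / (i :: σ).length) ≤ β) :
    delta d * Real.log (lowerRho d p).toReal ≤ β := by
  have hδ := delta_neg hd
  have h1 : Real.exp (β / delta d) ≤ (lowerRho d p).toReal := by
    refine le_lowerRho hd hm (Real.exp_pos _).le fun i σ hi0 him => ?_
    have hn : (0 : ℝ) < (i :: σ).length := by rw [List.length_cons]; positivity
    rw [← Real.log_le_log_iff (by positivity) (hpos _), Real.log_pow, Real.log_exp, mul_comm,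
      ← le_div_iff₀ hn, div_le_iff_of_neg hδ, mul_comm]
    exact h i σ hi0 him
  rw [← Real.le_log_iff_exp_le hρ, div_le_iff_of_neg hδ] at h1
  linarith

end Conclusion

end OverlapMeasure

/-! ### Assembly of the four claims -/

theorem theorem1 (d m : ℕ) (hd : 3 ≤ d) (hm : d ≤ m)
    (p : Fin (m + 1) → ℝ) (hp_pos : ∀ i, 0 < p i) (hp_sum : ∑ i, p i = 1)
    (hp_ends : p 0 ≤ p (Fin.last m))
    (hp_regular : ∀ i : Fin (m + 1), i ≠ 0 → i ≠ Fin.last m → p (Fin.last m) ≤ p i)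
    (μ : Measure ℝ) (hμ : OverlapMeasure.IsSelfSimilar d p μ) :
    ∃ αinf αstar : ℝ,
      -- the numbers `δ log ρ̃(M_0, …, M_m)` and `δ log ρ_(M_0, …, M_m)`
      (αinf : EReal) = (OverlapMeasure.delta d : EReal) *
        ENNReal.log (OverlapMeasure.genSpectralRadius (Set.range (OverlapMeasure.transfer d p))) ∧
      (αstar : EReal) = (OverlapMeasure.delta d : EReal) *
        ENNReal.log (OverlapMeasure.lowerRho d p) ∧
      -- 1. the infimum of the (lower) local dimensions
      sInf (OverlapMeasure.lowerDims μ) = (αinf : EReal) ∧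
      sInf (OverlapMeasure.localDims μ) = (αinf : EReal) ∧
      -- 2. the supremum of the (upper) local dimensions, which is attained
      IsGreatest (OverlapMeasure.upperDims μ)
        ((OverlapMeasure.delta d * Real.log (p 0) : ℝ) : EReal) ∧
      IsGreatest (OverlapMeasure.localDims μ)
        ((OverlapMeasure.delta d * Real.log (p 0) : ℝ) : EReal) ∧
      -- 3. the number `αstar` is the least one with the stated inclusion
      IsLeast {β : ℝ | OverlapMeasure.localDims μ ⊆
          Set.Icc (αinf : EReal) (β : EReal)
            ∪ {((OverlapMeasure.delta d * Real.log (p (Fin.last m)) : ℝ) : EReal)}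
            ∪ {((OverlapMeasure.delta d * Real.log (p 0) : ℝ) : EReal)}} αstar ∧
      -- 4. the gap
      ((∀ i : Fin (m + 1), i ≠ 0 → i ≠ Fin.last m → p 0 < p i) →
        αstar < OverlapMeasure.delta d * Real.log (p 0)) := by
  have hmin : ∀ i, p 0 ≤ p i := fun i => by
    by_cases h0 : i = 0
    · rw [h0]
    · by_cases hl : i = Fin.last m
      · rwa [hl]
      · exact hp_ends.trans (hp_regular i h0 hl)
  have hreg : ∀ i : Fin (m + 1), i ≠ 0 → p (Fin.last m) ≤ p i := fun i h0 => by
    by_cases hl : i = Fin.last m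
    · rw [hl]
    · exact hp_regular i h0 hl
  have hp1 : ∀ i, p i ≤ 1 := fun i => hp_sum ▸
    Finset.single_le_sum (fun j _ => (hp_pos j).le) (Finset.mem_univ i)
  have hlast : p (Fin.last m) ≠ 1 := fun h => by
    have h0 : (0 : Fin (m + 1)) ≠ Fin.last m := fun h => by
      have := congrArg Fin.val h
      simp at this
      omega
    have h1 := Finset.sum_le_sum_of_subset_of_nonneg
      (Finset.subset_univ {0, Fin.last m}) fun i _ _ => (hp_pos i).le
    rw [Finset.sum_pair h0, hp_sum, h] at h1
    linarith [hp_pos 0]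
  have hG : 0 < (OverlapMeasure.jointRho d p).toReal :=
    (hp_pos 0).trans_le (OverlapMeasure.le_jointRho hp_pos 0)
  have hρ : 0 < (OverlapMeasure.lowerRho d p).toReal :=
    (hp_pos 0).trans_le (OverlapMeasure.le_lowerRho_first hd hm hp_pos hmin)
  have hsupp := hμ.support_eq hd hm hp_pos hmin
  have hlower : ((OverlapMeasure.delta d * Real.log (OverlapMeasure.jointRho d p).toReal : ℝ)
      : EReal) ≤ sInf (OverlapMeasure.lowerDims μ) := by
    refine le_sInf ?_
    rintro _ ⟨x, hx, rfl⟩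
    rw [hsupp] at hx
    exact hμ.jointRho_le_lowerLocalDim hd hm hp_pos hmin hx
  have hsub : sInf (OverlapMeasure.lowerDims μ) ≤ sInf (OverlapMeasure.localDims μ) :=
    sInf_le_sInf fun _ ⟨x, hx, h, _⟩ => ⟨x, hx, h⟩
  have hinf := hμ.sInf_localDims_le hd hm hp_pos hmin
  have hupper : ∀ x ∈ μ.support, OverlapMeasure.upperLocalDim μ x ≤
      ((OverlapMeasure.delta d * Real.log (p 0) : ℝ) : EReal) := fun x hx => by
    rw [hsupp] at hx
    exact hμ.upperLocalDim_le_first hd hm hp_pos hmin hx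
  have hzero := OverlapMeasure.zero_mem_Icc hd hm
  have hdim := hμ.localDim_of_ball_eq hd hm hp_pos hmin hzero (hp_pos 0)
    (hμ.real_ball_zero hd hp_pos)
  refine ⟨OverlapMeasure.delta d * Real.log (OverlapMeasure.jointRho d p).toReal,
    OverlapMeasure.delta d * Real.log (OverlapMeasure.lowerRho d p).toReal,
    OverlapMeasure.coe_delta_mul_log hG, OverlapMeasure.coe_delta_mul_log hρ,
    le_antisymm (hsub.trans hinf) hlower, le_antisymm hinf (hlower.trans hsub),
    ⟨⟨0, by rwa [hsupp], hdim.2⟩, ?_⟩, ⟨⟨0, by rwa [hsupp], hdim⟩, ?_⟩,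
    ⟨hμ.localDims_subset hd hm hp_pos hmin, fun β hβ => ?_⟩, fun h => ?_⟩
  · rintro _ ⟨x, hx, rfl⟩
    exact hupper x hx
  · rintro _ ⟨x, hx, -, rfl⟩
    exact hupper x hx
  · exact OverlapMeasure.log_lowerRho_le hd hm hρ
      (OverlapMeasure.realRho_wordMatrix_pos hp_pos hmin) fun i σ hi0 him =>
      hμ.rate_le_of_localDims_subset hd hm hp_pos hmin (hp1 _) hlast hreg hβ hi0 him σ
  · exact mul_lt_mul_of_neg_left
      (Real.log_lt_log (hp_pos 0) (OverlapMeasure.lt_lowerRho hd hm hp_pos hmin hp1 h))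
      (OverlapMeasure.delta_neg hd)
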